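/- An SSP instance has a finite state space $\mathcal S$, a goal $g\notin\mathcal S$, an initial state $s_{\mathrm{init}}$, a finite action set $\mathcal A$, costs $c(s,a)\in[0,1]$ and transition laws $P_{s,a}$ on $\mathcal S_+=\mathcal S\cup\{g\}$. A stationary deterministic policy is proper if it reaches $g$ almost surely from every state; $V^\star(s)$ is the minimum over proper policies of the expected total cost from $s$ until $g$ is reached (with $V^\star(g)=0$), $Q^\star(s,a)=c(s,a)+\mathbb E_{s'\sim P_{s,a}}[V^\star(s')]$, $B_\star=\max_s V^\star(s)$, and $\mathrm{gap}_{\min}$ is the smallest positive value of $Q^\star(s,a)-V^\star(s)$. The instance is a linear SSP of dimension $m$ with feature map $\phi:\mathcal S\times\mathcal A\to\mathbb R^m$ and cost parameter $\theta\in\mathbb R^m$ if $c(s,a)=\langle\phi(s,a),\theta\rangle$, $\|\phi(s,a)\|_2\le 1$, $\|\theta\|_2\le\sqrt m$, and there are $\mu(s')\in\mathbb R^m$, $s'\in\mathcal S_+$, with $P_{s,a}(s')=\langle\phi(s,a),\mu(s')\rangle$ and $\|\sum_{s'}h(s')\mu(s')\|_2\le\sqrt m\,\|h\|_\infty$ for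 all $h:\mathcal S_+\to\mathbb R$. A learner is a randomized, history-dependent rule for choosing actions. Each episode starts in $s_{\mathrm{init}}$ and ends when $g$ is reached. The regret is $R_K=C_K-K\,V^\star(s_{\mathrm{init}})$, where $C_K$ is the total cost of the first $K$ episodes, and $C_K=\infty$ if they are never completed. **Theorem.** There are absolute constants $c,c_1,c_2>0$ such that for all integers $d\ge 2$ and $K\ge\frac32 d^2$ and every real $B>1$ the following holds. There are a feature map $\phi:\mathcal S\times\mathcal A\to\mathbb R^{d+2}$ with $|\mathcal S|=2$ and $\mathcal A=\{-1,1\}^d$, a parameter $\theta\in\mathbb R^{d+2}$, a state $s_0\in\mathcal S$, some $\tau\in[0,\infty]$, and a real $\gamma$ with $$c_1\frac{B}{\sqrt K}\le\gamma\le c_2\frac{B}{\sqrt K},$$ such that for every learner (which may depend on all of the above) there is a linear SSP instance of dimension $d+2$ with feature map $\phi$, cost parameter $\theta$ and initial state $s_0$, which has $B_\star=B$, $\mathrm{gap}_{\min}=\gamma$ and an optimal proper policy whose maximal expected hitting time of $g$ over all starting states is $\tau$, and on which $$\mathbb E[R_K]\ \ge\ c\,\frac{d\,B_\star^2}{\mathrm{gap}_{\min}}\qquad\text{and}\qquad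 \mathbb E[R_K]\ \ge\ c\,B_\star d\sqrt K .$$ -/

import Mathlib

open scoped ENNReal Topology

noncomputable section

/-- A stochastic shortest path instance with states `S`, actions `A`, and costs in `[0, 1]`.
The goal is a point outside `S`: the space `S ∪ {g}` is `Option S`, where `none` is the goal. -/
structure SSP (S A : Type) where
  init : S
  cost : S → A → ℝ
  cost_nonneg : ∀ s a, 0 ≤ cost s a
  cost_le_one : ∀ s a, cost s a ≤ 1
  trans : S → A → PMF (Option S)

/-- One observed triplet: state, action, next state (`none` if the goal was reached). -/
@[ext] structure Transition (S A : Type) where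
  state : S
  action : A
  next : Option S

namespace Transition

variable {S A : Type}

instance : MeasurableSpace (Transition S A) := ⊤

instance : DiscreteMeasurableSpace (Transition S A) := ⟨fun _ => trivial⟩

instance [Countable S] [Countable A] : Countable (Transition S A) :=
  Function.Injective.countable
    (f := fun x : Transition S A => (x.state, x.action, x.next)) fun x y h => by
      simp only [Prod.mk.injEq] at h
      exact Transition.ext h.1 h.2.1 h.2.2

end Transition

/-- A (randomized, history dependent) learner: the law of the next action, given the list of all
triplets observed so far, over all episodes and in chronological order, and the current state. -/
abbrev Learner (S A : Type) := List (Transition S A) → S → PMF A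

namespace SSP

variable {S A : Type}

section Policies

variable [Fintype S] (M : SSP S A)

/-- The law of the state after `n` steps of the stationary policy `π` from `s`;
the goal is absorbing. -/
def stateLaw (π : S → A) (s : S) : ℕ → PMF (Option S)
  | 0 => PMF.pure (some s)
  | n + 1 => (stateLaw π s n).bind fun z =>
      match z with
      | none => PMF.pure none
      | some x => M.trans x (π x)

/-- The goal is reached with probability one from every state. As the goal is absorbing, the
probability of ever reaching it is the limit of the probabilities of being there at time `n`. -/
def IsProper (π : S → A) : Prop :=
  ∀ s, Filter.Tendsto (fun n => M.stateLaw π s n none) Filter.atTop (𝓝 1)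

/-- `V^π(s)`, the expected total cost of `π` from `s` before the goal is reached. -/
def value (π : S → A) (s : S) : ℝ≥0∞ :=
  ∑' n, ∑ x, M.stateLaw π s n (some x) * ENNReal.ofReal (M.cost x (π x))

/-- `T^π(s)`, the expected number of steps of `π` from `s` before the goal is reached. -/
def hittingTime (π : S → A) (s : S) : ℝ≥0∞ :=
  ∑' n, ∑ x, M.stateLaw π s n (some x)

/-- `V⋆(s)`, the least value over all proper policies (`⊤` if there is none). -/
def optValue (s : S) : ℝ≥0∞ :=
  ⨅ (π : S → A) (_ : M.IsProper π), M.value π s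

/-- `π` is proper and attains `V⋆` at every state. -/
def IsOptimal (π : S → A) : Prop :=
  M.IsProper π ∧ ∀ s, M.value π s = M.optValue s

/-- `B⋆`, the maximum of `V⋆`. -/
def Bstar : ℝ≥0∞ := ⨆ s, M.optValue s

/-- `Q⋆(s, a) = c(s, a) + E[V⋆(s')]` with `s'` drawn from `P_{s,a}` and `V⋆ = 0` at the goal. -/
def optQ (s : S) (a : A) : ℝ :=
  M.cost s a + ∑ x, (M.trans s a (some x)).toReal * (M.optValue x).toReal

/-- The sub-optimality gap `Q⋆(s, a) - V⋆(s)`. -/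
def gap (s : S) (a : A) : ℝ := M.optQ s a - (M.optValue s).toReal

/-- The smallest positive sub-optimality gap. -/
def gapMin : ℝ := sInf {x : ℝ | 0 < x ∧ ∃ s a, M.gap s a = x}

/-- The linear structure with feature map `φ` and cost parameter `θ` in dimension `m`. The norm
`‖h‖` is the supremum norm. -/
def IsLinear {m : ℕ} (φ : S → A → EuclideanSpace ℝ (Fin m)) (θ : EuclideanSpace ℝ (Fin m)) :
    Prop :=
  (∀ s a, M.cost s a = inner ℝ (φ s a) θ) ∧
  (∀ s a, ‖φ s a‖ ≤ 1) ∧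
  ‖θ‖ ≤ √(m : ℝ) ∧
  ∃ μ : Option S → EuclideanSpace ℝ (Fin m),
    (∀ s a z, (M.trans s a z).toReal = inner ℝ (φ s a) (μ z)) ∧
    ∀ h : Option S → ℝ, ‖∑ z, h z • μ z‖ ≤ √(m : ℝ) * ‖h‖

end Policies

section Interaction

variable (M : SSP S A)

/-- The state after the history `h`: the initial state if nothing happened yet or if the last step
reached the goal (a new episode starts), and otherwise the last next state. -/
def currentState (h : List (Transition S A)) : S :=
  (h.getLast?.bind Transition.next).getD M.init

/-- The law of the next triplet after the history `h`, when the learner `L` acts on `M`. -/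
def stepLaw (L : Learner S A) (h : List (Transition S A)) : PMF (Transition S A) :=
  (L h (M.currentState h)).bind fun a =>
    (M.trans (M.currentState h) a).map fun z => ⟨M.currentState h, a, z⟩

/-- The history made of the triplets at times `0, …, n`. -/
def history {n : ℕ} (x : Finset.Iic n → Transition S A) : List (Transition S A) :=
  List.ofFn fun i : Fin (n + 1) => x ⟨i, Finset.mem_Iic.2 (Nat.lt_succ_iff.1 i.2)⟩

/-- The law of the triplet at time `n + 1`, as a kernel from the triplets at times `0, …, n`. -/
def stepKernel [Countable S] [Countable A] (L : Learner S A) (n : ℕ) :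
    ProbabilityTheory.Kernel (Finset.Iic n → Transition S A) (Transition S A) :=
  ProbabilityTheory.Kernel.ofFunOfCountable fun x => (M.stepLaw L (history x)).toMeasure

instance [Countable S] [Countable A] (L : Learner S A) (n : ℕ) :
    ProbabilityTheory.IsMarkovKernel (M.stepKernel L n) :=
  ⟨fun x => PMF.toMeasure.isProbabilityMeasure (M.stepLaw L (history x))⟩

/-- The law of the infinite sequence of triplets produced by `L` on `M`. Episodes follow one another
without end; the regret below counts the first `K` of them only. -/
def law [Countable S] [Countable A] (L : Learner S A) :
    MeasureTheory.Measure (ℕ → Transition S A) :=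
  ProbabilityTheory.Kernel.trajMeasure (X := fun _ => Transition S A)
    (M.stepLaw L []).toMeasure (M.stepKernel L)

/-- The number of episodes that are finished before step `t`. -/
def episodesDone (ω : ℕ → Transition S A) (t : ℕ) : ℕ :=
  ((Finset.range t).filter fun i => (ω i).next.isNone).card

open Classical in
/-- The total cost of the first `K` episodes, and `⊤` if they are never finished. Step `t` belongs
to them if fewer than `K` episodes are finished before it. -/
def totalCost (K : ℕ) (ω : ℕ → Transition S A) : ℝ≥0∞ :=
  if ∀ t, episodesDone ω t < K then ⊤
  else ∑' t, if episodesDone ω t < K then ENNReal.ofReal (M.cost (ω t).state (ω t).action) else 0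

/-- The expected regret `E[R_K]` of `L` on `M`, as an extended real number. -/
def expectedRegret [Fintype S] [Countable A] (L : Learner S A) (K : ℕ) : EReal :=
  ((∫⁻ ω, M.totalCost K ω ∂(M.law L) : ℝ≥0∞) : EReal) -
    (((K : ℝ) * (M.optValue M.init).toReal : ℝ) : EReal)

end Interaction

end SSP

end

/-! The state `0` is free and is left at once: to the goal with probability `1/2 + D⟨a, w⟩` for a
hidden sign vector `w`, otherwise to the state `1`, where each step costs one and the goal is hit
with probability `1/B` whatever the action. An episode is thus one pull of a linear bandit on the
hypercube whose failure costs `B` on average; every coordinate in which the action disagrees with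
`w` costs `2DB`, which is also the minimal gap. For `D = 1/(4√K)`, flipping one coordinate of `w`
cannot be detected reliably in `K` episodes. Averaged over `w`, a constant fraction of the visits is
therefore wrong in each coordinate, and the regret is of order `DB · dK`, that is `Bd√K`. As the gap
is `B/(2√K)`, both claimed bounds are this one.

Expectations are finite sums over histories up to a horizon `n` (`total`). Under two instances the
probability of a history differs only in the transition factors, so the geometric mean of the two is
again a `total`, with weights `√(uu')` and `√(vv')`. `two_point` bounds the errors below by this
Hellinger affinity, and `le_total_visit` shows that the affinity kernel still sees about `K/2`
visits. `le_total_stepCost` turns errors into regret, `exists_le_sum_meanMiss` selects `w`, and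
`total_stepCost_le` returns to the law of the learner. The potential arguments leave remainders that
decay geometrically in `n`. -/

/-! ### Additive functionals of two-state histories -/

namespace TwoState

variable {A : Type}

/-- The state after a history, when episodes start in `0`. -/
def curr (h : List (Transition (Fin 2) A)) : Fin 2 :=
  (h.getLast?.bind Transition.next).getD 0

/-- The number of episodes finished in a history. -/
def goals (h : List (Transition (Fin 2) A)) : ℕ := h.countP fun x => x.next.isNone

/-- The history `h`, extended by action `a` and a move to the goal. -/
def exit (h : List (Transition (Fin 2) A)) (a : A) : List (Transition (Fin 2) A) :=
  h ++ [⟨curr h, a, none⟩]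

/-- The history `h`, extended by action `a` and a move to the state `1`. -/
def stay (h : List (Transition (Fin 2) A)) (a : A) : List (Transition (Fin 2) A) :=
  h ++ [⟨curr h, a, some 1⟩]

@[simp] lemma curr_nil : curr ([] : List (Transition (Fin 2) A)) = 0 := rfl

@[simp] lemma goals_nil : goals ([] : List (Transition (Fin 2) A)) = 0 := rfl

@[simp] lemma curr_exit (h : List (Transition (Fin 2) A)) (a : A) : curr (exit h a) = 0 := by
  simp [curr, exit]

@[simp] lemma curr_stay (h : List (Transition (Fin 2) A)) (a : A) : curr (stay h a) = 1 := by
  simp [curr, stay]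

@[simp] lemma goals_exit (h : List (Transition (Fin 2) A)) (a : A) :
    goals (exit h a) = goals h + 1 := by
  simp [goals, exit]

@[simp] lemma goals_stay (h : List (Transition (Fin 2) A)) (a : A) :
    goals (stay h a) = goals h := by
  simp [goals, stay]

variable [Fintype A]

/-- The sum of `f` over the one-step extensions of `h`, where action `a` has weight `l h a`,
the goal has weight `u s a` and the state `1` has weight `v s a`. -/
def avg (l : List (Transition (Fin 2) A) → A → ℝ) (u v : Fin 2 → A → ℝ)
    (f : List (Transition (Fin 2) A) → ℝ) (h : List (Transition (Fin 2) A)) : ℝ :=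
  ∑ a, l h a * (u (curr h) a * f (exit h a) + v (curr h) a * f (stay h a))

/-- The weighted sum of `g` over the extensions of `h` by fewer than `n` steps. -/
def total (l : List (Transition (Fin 2) A) → A → ℝ) (u v : Fin 2 → A → ℝ)
    (g : List (Transition (Fin 2) A) → ℝ) : ℕ → List (Transition (Fin 2) A) → ℝ
  | 0, _ => 0
  | n + 1, h => g h + avg l u v (total l u v g n) h

variable {l : List (Transition (Fin 2) A) → A → ℝ} {u v : Fin 2 → A → ℝ}

lemma avg_mono (hl : ∀ h a, 0 ≤ l h a) (hu : ∀ s a, 0 ≤ u s a) (hv : ∀ s a, 0 ≤ v s a)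
    {f g : List (Transition (Fin 2) A) → ℝ} (hfg : ∀ h, f h ≤ g h)
    (h : List (Transition (Fin 2) A)) : avg l u v f h ≤ avg l u v g h :=
  Finset.sum_le_sum fun _ _ => mul_le_mul_of_nonneg_left
    (add_le_add (mul_le_mul_of_nonneg_left (hfg _) (hu _ _))
      (mul_le_mul_of_nonneg_left (hfg _) (hv _ _))) (hl _ _)

lemma avg_add (f g : List (Transition (Fin 2) A) → ℝ) (h : List (Transition (Fin 2) A)) :
    avg l u v (fun h => f h + g h) h = avg l u v f h + avg l u v g h := by
  simp only [avg, ← Finset.sum_add_distrib]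
  exact Finset.sum_congr rfl fun a _ => by ring

lemma avg_const_mul (c : ℝ) (f : List (Transition (Fin 2) A) → ℝ)
    (h : List (Transition (Fin 2) A)) :
    avg l u v (fun h => c * f h) h = c * avg l u v f h := by
  simp only [avg, Finset.mul_sum]
  exact Finset.sum_congr rfl fun a _ => by ring

lemma total_add (f g : List (Transition (Fin 2) A) → ℝ) (n : ℕ)
    (h : List (Transition (Fin 2) A)) :
    total l u v (fun h => f h + g h) n h = total l u v f n h + total l u v g n h := by
  induction n generalizing h with
  | zero => simp [total]
  | succ n ih =>
    have : total l u v (fun h => f h + g h) n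
        = fun h => total l u v f n h + total l u v g n h := funext ih
    simp only [total]
    rw [this, avg_add]
    ring

lemma total_const_mul (c : ℝ) (g : List (Transition (Fin 2) A) → ℝ) (n : ℕ)
    (h : List (Transition (Fin 2) A)) :
    total l u v (fun h => c * g h) n h = c * total l u v g n h := by
  induction n generalizing h with
  | zero => simp [total]
  | succ n ih =>
    have : total l u v (fun h => c * g h) n = fun h => c * total l u v g n h := funext ih
    simp only [total]
    rw [this, avg_const_mul]
    ring

lemma total_zero (n : ℕ) (h : List (Transition (Fin 2) A)) :
    total l u v (fun _ => 0) n h = 0 := by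
  simpa using total_const_mul (l := l) (u := u) (v := v) 0 (fun _ => 0) n h

lemma total_sum {ι : Type} (s : Finset ι) (g : ι → List (Transition (Fin 2) A) → ℝ) (n : ℕ)
    (h : List (Transition (Fin 2) A)) :
    total l u v (fun h => ∑ i ∈ s, g i h) n h = ∑ i ∈ s, total l u v (g i) n h := by
  classical
  induction s using Finset.induction_on with
  | empty => simpa using total_zero n h
  | insert i s hi ih => simp only [Finset.sum_insert hi, total_add, ih]

lemma total_nonneg (hl : ∀ h a, 0 ≤ l h a) (hu : ∀ s a, 0 ≤ u s a) (hv : ∀ s a, 0 ≤ v s a)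
    {g : List (Transition (Fin 2) A) → ℝ} (hg : ∀ h, 0 ≤ g h) (n : ℕ)
    (h : List (Transition (Fin 2) A)) : 0 ≤ total l u v g n h := by
  induction n generalizing h with
  | zero => exact le_rfl
  | succ n ih =>
    exact add_nonneg (hg h) (Finset.sum_nonneg fun a _ => mul_nonneg (hl _ _)
      (add_nonneg (mul_nonneg (hu _ _) (ih _)) (mul_nonneg (hv _ _) (ih _))))

/-- Optional stopping: a nonnegative potential that pays for `g` at every step covers whatever is
collected. -/
lemma total_le_of_superharmonic (hl : ∀ h a, 0 ≤ l h a) (hu : ∀ s a, 0 ≤ u s a)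
    (hv : ∀ s a, 0 ≤ v s a) {g p : List (Transition (Fin 2) A) → ℝ} (hp : ∀ h, 0 ≤ p h)
    (hgp : ∀ h, g h + avg l u v p h ≤ p h) (n : ℕ) (h : List (Transition (Fin 2) A)) :
    total l u v g n h ≤ p h := by
  induction n generalizing h with
  | zero => exact hp h
  | succ n ih => exact (add_le_add_right (avg_mono hl hu hv ih h) _).trans (hgp h)

/-- With weight at least `r` an episode ends and the power is halved; the total weight is at most
one. -/
lemma avg_goals_pow_le (hl : ∀ h a, 0 ≤ l h a) (hl1 : ∀ h, ∑ a, l h a = 1) {r : ℝ}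
    (hur : ∀ s a, r ≤ u s a) (huv : ∀ s a, u s a + v s a ≤ 1)
    (h : List (Transition (Fin 2) A)) :
    avg l u v (fun h => (1 / 2) ^ goals h) h ≤ (1 - r / 2) * (1 / 2) ^ goals h := by
  have key : ∀ a, l h a * (u (curr h) a * (1 / 2) ^ goals (exit h a)
      + v (curr h) a * (1 / 2) ^ goals (stay h a))
      ≤ l h a * ((1 - r / 2) * (1 / 2) ^ goals h) := fun a => by
    refine mul_le_mul_of_nonneg_left ?_ (hl h a)
    have h1 := hur (curr h) a
    have h2 := huv (curr h) a
    rw [goals_exit, goals_stay, pow_succ]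
    have h3 : (0 : ℝ) ≤ (1 / 2) ^ goals h := by positivity
    nlinarith
  refine (Finset.sum_le_sum fun a _ => key a).trans ?_
  rw [← Finset.sum_mul, hl1, one_mul]

/-- Here the potential left after `n` steps must be controlled. It is dominated by a multiple of
`(1/2) ^ goals`, which contracts by `1 - r/2` per step (`avg_goals_pow_le`). -/
lemma le_total_of_subharmonic (hl : ∀ h a, 0 ≤ l h a) (hl1 : ∀ h, ∑ a, l h a = 1)
    (hu : ∀ s a, 0 ≤ u s a) (hv : ∀ s a, 0 ≤ v s a) {r : ℝ} (hr : r ≤ 1)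
    (hur : ∀ s a, r ≤ u s a) (huv : ∀ s a, u s a + v s a ≤ 1)
    {g p : List (Transition (Fin 2) A) → ℝ} {C : ℝ} (hC : 0 ≤ C)
    (hpC : ∀ h, p h ≤ C * (1 / 2) ^ goals h)
    (hgp : ∀ h, p h ≤ g h + avg l u v p h) (n : ℕ) (h : List (Transition (Fin 2) A)) :
    p h ≤ total l u v g n h + C * (1 - r / 2) ^ n * (1 / 2) ^ goals h := by
  induction n generalizing h with
  | zero => simpa [total] using hpC h
  | succ n ih =>
    have h1 := avg_mono hl hu hv ih h
    rw [avg_add, avg_const_mul] at h1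
    have h2 := mul_le_mul_of_nonneg_left (avg_goals_pow_le hl hl1 hur huv h)
      (mul_nonneg hC (pow_nonneg (by linarith : (0 : ℝ) ≤ 1 - r / 2) n))
    have h3 := hgp h
    simp only [total, pow_succ]
    linarith

/-! ### The two-point inequality -/

/-- Expand `(√p - c√q)² ≥ 0`, or the same with `p` and `q` exchanged. The correction is linear in `p
+ q`, so the bound can be summed over histories. -/
lemma two_mul_sqrt_sub_le_min {p q : ℝ} (hp : 0 ≤ p) (hq : 0 ≤ q) (c : ℝ) :
    2 * c * √(p * q) - c ^ 2 * (p + q) ≤ min p q := by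
  rw [Real.sqrt_mul hp]
  have hp' := Real.sq_sqrt hp
  have hq' := Real.sq_sqrt hq
  rcases le_total p q with h | h
  · rw [min_eq_left h]
    nlinarith [sq_nonneg (√p - c * √q), mul_nonneg (sq_nonneg c) hp]
  · rw [min_eq_right h]
    nlinarith [sq_nonneg (√q - c * √p), mul_nonneg (sq_nonneg c) hq]

/-- The numbers `p` and `q` carry the transition probabilities of the past under the two instances;
the factors of the learner are common to both. Unfolded, this is `two_mul_sqrt_sub_le_min` times `g₁
+ g₂`, summed over histories. -/
lemma two_point_aux (hl : ∀ h a, 0 ≤ l h a) {u' v' : Fin 2 → A → ℝ}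
    (hu : ∀ s a, 0 ≤ u s a) (hv : ∀ s a, 0 ≤ v s a)
    (hu' : ∀ s a, 0 ≤ u' s a) (hv' : ∀ s a, 0 ≤ v' s a)
    {g₁ g₂ : List (Transition (Fin 2) A) → ℝ} (h₁ : ∀ h, 0 ≤ g₁ h) (h₂ : ∀ h, 0 ≤ g₂ h)
    (c : ℝ) (n : ℕ) (h : List (Transition (Fin 2) A)) (p q : ℝ) (hp : 0 ≤ p) (hq : 0 ≤ q) :
    2 * c * √(p * q) * total l (fun s a => √(u s a * u' s a)) (fun s a => √(v s a * v' s a))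
        (fun h => g₁ h + g₂ h) n h
      - c ^ 2 * (p * total l u v (fun h => g₁ h + g₂ h) n h
        + q * total l u' v' (fun h => g₁ h + g₂ h) n h)
      ≤ p * total l u v g₁ n h + q * total l u' v' g₂ n h := by
  induction n generalizing h p q with
  | zero => simp [total]
  | succ n ih =>
    have base : (2 * c * √(p * q) - c ^ 2 * (p + q)) * (g₁ h + g₂ h) ≤ p * g₁ h + q * g₂ h := by
      refine (mul_le_mul_of_nonneg_right (two_mul_sqrt_sub_le_min hp hq c)
        (add_nonneg (h₁ h) (h₂ h))).trans ?_
      nlinarith [mul_le_mul_of_nonneg_right (min_le_left p q) (h₁ h),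
        mul_le_mul_of_nonneg_right (min_le_right p q) (h₂ h)]
    have step : ∀ a, _ := fun a => mul_le_mul_of_nonneg_left (add_le_add
      (ih (exit h a) (p * u (curr h) a) (q * u' (curr h) a)
        (mul_nonneg hp (hu _ _)) (mul_nonneg hq (hu' _ _)))
      (ih (stay h a) (p * v (curr h) a) (q * v' (curr h) a)
        (mul_nonneg hp (hv _ _)) (mul_nonneg hq (hv' _ _)))) (hl h a)
    have sum := Finset.sum_le_sum fun a (_ : a ∈ Finset.univ) => step a
    -- `√(pu · qu')` splits as `√(pq) · √(uu')`, which produces the weights of the affinity kernel.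
    simp only [mul_mul_mul_comm p _ q, Real.sqrt_mul (mul_nonneg hp hq)] at sum
    refine le_trans (le_of_eq ?_) ((add_le_add base sum).trans (le_of_eq ?_))
    · simp only [total, avg, mul_add, add_mul, sub_mul, mul_sub, Finset.mul_sum,
        Finset.sum_add_distrib, Finset.sum_sub_distrib]
      simp only [mul_assoc, mul_left_comm, mul_comm]
      ring
    · simp only [total, avg, mul_add, Finset.mul_sum, Finset.sum_add_distrib]
      simp only [mul_assoc, mul_left_comm]
      ring

lemma two_point (hl : ∀ h a, 0 ≤ l h a) {u' v' : Fin 2 → A → ℝ}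
    (hu : ∀ s a, 0 ≤ u s a) (hv : ∀ s a, 0 ≤ v s a)
    (hu' : ∀ s a, 0 ≤ u' s a) (hv' : ∀ s a, 0 ≤ v' s a)
    {g₁ g₂ : List (Transition (Fin 2) A) → ℝ} (h₁ : ∀ h, 0 ≤ g₁ h) (h₂ : ∀ h, 0 ≤ g₂ h)
    (c : ℝ) (n : ℕ) (h : List (Transition (Fin 2) A)) :
    2 * c * total l (fun s a => √(u s a * u' s a)) (fun s a => √(v s a * v' s a))
        (fun h => g₁ h + g₂ h) n h
      - c ^ 2 * (total l u v (fun h => g₁ h + g₂ h) n h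
        + total l u' v' (fun h => g₁ h + g₂ h) n h)
      ≤ total l u v g₁ n h + total l u' v' g₂ n h := by
  simpa using two_point_aux hl hu hv hu' hv' h₁ h₂ c n h 1 1 zero_le_one zero_le_one

end TwoState

/-! ### Finite-horizon expectations under the law of a learner -/

namespace SSP

open MeasureTheory ProbabilityTheory

variable {S A : Type} (M : SSP S A) (L : Learner S A)

/-- The conditional expectation of `F` of the history after one more step. -/
noncomputable def stepMean (F : List (Transition S A) → ℝ≥0∞) (h : List (Transition S A)) : ℝ≥0∞ :=
  ∫⁻ x, F (h ++ [x]) ∂(M.stepLaw L h).toMeasure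

/-- The conditional expectation of the sum of `g` over the next `n` histories. -/
noncomputable def runningMean (g : List (Transition S A) → ℝ≥0∞) : ℕ → List (Transition S A) → ℝ≥0∞
  | 0, _ => 0
  | n + 1, h => g h + stepMean M L (runningMean g n) h

/-- The history made of the first `n` triplets of `ω`. -/
def initialSegment (n : ℕ) (ω : ℕ → Transition S A) : List (Transition S A) :=
  List.ofFn fun i : Fin n => ω i

lemma initialSegment_succ (n : ℕ) (ω : ℕ → Transition S A) :
    initialSegment (n + 1) ω = initialSegment n ω ++ [ω n] := by
  rw [initialSegment, List.ofFn_succ_last]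
  rfl

lemma countP_initialSegment (n : ℕ) (ω : ℕ → Transition S A) :
    (initialSegment n ω).countP (fun x => x.next.isNone) = episodesDone ω n := by
  induction n with
  | zero => rfl
  | succ n ih =>
    rw [initialSegment_succ, List.countP_append, ih, episodesDone, episodesDone,
      Finset.range_add_one, Finset.filter_insert]
    by_cases h : (ω n).next.isNone
    · rw [if_pos h, Finset.card_insert_of_notMem (by simp)]
      simp [h]
    · rw [if_neg h]
      simp [h]

variable [Countable S] [Countable A]

instance : IsProbabilityMeasure (M.law L) := by
  unfold law
  have : IsProbabilityMeasure (M.stepLaw L []).toMeasure := PMF.toMeasure.isProbabilityMeasure _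
  infer_instance

lemma law_map_zero : (M.law L).map (fun ω => ω 0) = (M.stepLaw L []).toMeasure := by
  have h0 : (fun ω : ℕ → Transition S A => ω 0) =
      (MeasurableEquiv.piUnique (fun _ : Finset.Iic 0 => Transition S A)) ∘
        Preorder.frestrictLe (π := fun _ => Transition S A) 0 := by
    funext ω
    rfl
  rw [h0, ← Measure.map_map (by fun_prop) (by fun_prop), law, Kernel.trajMeasure,
    Measure.map_comp _ _ (by fun_prop), Kernel.traj_map_frestrictLe, Kernel.partialTraj_self,
    Measure.id_comp, Measure.map_map (by fun_prop) (by fun_prop)]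
  exact Measure.map_id

/-- The trajectory measure consists of an initial law and kernels from time `1` on, hence the
separate case of time `0`. Later, the joint law of the past and the next triplet is a composition
product. -/
lemma lintegral_law_step (F : List (Transition S A) → Transition S A → ℝ≥0∞) (n : ℕ) :
    ∫⁻ ω, F (initialSegment n ω) (ω n) ∂(M.law L) =
      ∫⁻ ω, ∫⁻ x, F (initialSegment n ω) x ∂(M.stepLaw L (initialSegment n ω)).toMeasure
        ∂(M.law L) := by
  cases n with
  | zero =>
    have h : ∀ ω : ℕ → Transition S A, initialSegment 0 ω = [] := fun ω => rfl
    simp only [h, lintegral_const, measure_univ, mul_one]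
    rw [← law_map_zero, lintegral_map .of_discrete (by fun_prop)]
  | succ n =>
    have hmap : ((M.law L).map (Preorder.frestrictLe n)) ⊗ₘ (M.stepKernel L n) =
        (M.law L).map (fun ω => (Preorder.frestrictLe n ω, ω (n + 1))) := by
      have : IsProbabilityMeasure (M.stepLaw L []).toMeasure :=
        PMF.toMeasure.isProbabilityMeasure _
      exact Kernel.map_frestrictLe_trajMeasure_compProd_eq_map_trajMeasure
        (X := fun _ => Transition S A) (κ := M.stepKernel L)
    have hF : Measurable fun p : (Finset.Iic n → Transition S A) × Transition S A =>
        F (history p.1) p.2 := .of_discrete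
    have h1 : ∫⁻ ω, F (initialSegment (n + 1) ω) (ω (n + 1)) ∂(M.law L) =
        ∫⁻ p, F (history p.1) p.2
          ∂((M.law L).map (fun ω => (Preorder.frestrictLe n ω, ω (n + 1)))) := by
      rw [lintegral_map hF (by fun_prop)]
      rfl
    rw [h1, ← hmap, Measure.lintegral_compProd hF,
      lintegral_map .of_discrete (by fun_prop)]
    rfl

lemma lintegral_initialSegment_succ (F : List (Transition S A) → ℝ≥0∞) (n : ℕ) :
    ∫⁻ ω, F (initialSegment (n + 1) ω) ∂(M.law L) =
      ∫⁻ ω, stepMean M L F (initialSegment n ω) ∂(M.law L) := by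
  simp only [initialSegment_succ]
  exact lintegral_law_step M L (fun h x => F (h ++ [x])) n

lemma measurable_comp_initialSegment (F : List (Transition S A) → ℝ≥0∞) (n : ℕ) :
    Measurable fun ω => F (initialSegment n ω) := by
  have : Measurable fun x : Fin n → Transition S A => F (List.ofFn x) := .of_discrete
  exact this.comp (measurable_pi_lambda (fun ω : ℕ → Transition S A => fun i : Fin n => ω i)
    fun i => measurable_pi_apply _)

/-- The shift `k` makes the induction on `n` work; only `k = 0` is used later. -/
lemma sum_lintegral_initialSegment_add (g : List (Transition S A) → ℝ≥0∞) (n k : ℕ) :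
    ∑ t ∈ Finset.range n, ∫⁻ ω, g (initialSegment (k + t) ω) ∂(M.law L) =
      ∫⁻ ω, runningMean M L g n (initialSegment k ω) ∂(M.law L) := by
  induction n generalizing k with
  | zero => simp [runningMean]
  | succ n ih =>
    rw [Finset.sum_range_succ']
    simp only [← add_assoc, add_right_comm k _ 1, ih, runningMean, add_zero]
    rw [lintegral_add_left (measurable_comp_initialSegment g k), lintegral_initialSegment_succ,
      add_comm]

lemma sum_lintegral_initialSegment (g : List (Transition S A) → ℝ≥0∞) (n : ℕ) :
    ∑ t ∈ Finset.range n, ∫⁻ ω, g (initialSegment t ω) ∂(M.law L) = runningMean M L g n [] := by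
  have h := sum_lintegral_initialSegment_add M L g n 0
  have h0 : ∀ ω : ℕ → Transition S A, initialSegment 0 ω = [] := fun ω => rfl
  simpa [h0] using h

/-- The expected cost of the next step, counted while fewer than `K` episodes are finished. -/
noncomputable def meanCost (K : ℕ) (h : List (Transition S A)) : ℝ≥0∞ :=
  ∫⁻ x, (if h.countP (fun x => x.next.isNone) < K then
    ENNReal.ofReal (M.cost x.state x.action) else 0) ∂(M.stepLaw L h).toMeasure

/-- The left side is a partial sum of the expected cost series. Where the `K` episodes never finish,
the total cost is `⊤` and nothing is to be shown. -/
lemma runningMean_meanCost_le (K n : ℕ) :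
    runningMean M L (meanCost M L K) n [] ≤ ∫⁻ ω, M.totalCost K ω ∂(M.law L) := by
  have hm : ∀ t, Measurable fun ω : ℕ → Transition S A =>
      if episodesDone ω t < K then ENNReal.ofReal (M.cost (ω t).state (ω t).action) else 0 := by
    intro t
    -- The summand at time `t` is a function of the first `t + 1` triplets: the episode count
    -- ignores the last one, the cost reads only that one.
    have h := measurable_comp_initialSegment (S := S) (A := A) (fun h =>
      if h.dropLast.countP (fun x => x.next.isNone) < K then
        (h.getLast?.elim 0 fun x => ENNReal.ofReal (M.cost x.state x.action)) else 0) (t + 1)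
    simpa only [initialSegment_succ, List.dropLast_concat, List.getLast?_concat, Option.elim_some,
      countP_initialSegment] using h
  rw [← sum_lintegral_initialSegment]
  have hs : ∀ t, ∫⁻ ω, meanCost M L K (initialSegment t ω) ∂(M.law L) = ∫⁻ ω,
      (if episodesDone ω t < K then ENNReal.ofReal (M.cost (ω t).state (ω t).action) else 0)
        ∂(M.law L) := fun t => by
    simp only [← countP_initialSegment]
    exact (lintegral_law_step M L (fun h x => if h.countP (fun x => x.next.isNone) < K then
      ENNReal.ofReal (M.cost x.state x.action) else 0) t).symm
  simp only [hs]
  rw [← lintegral_finsetSum _ fun t _ => hm t]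
  refine lintegral_mono fun ω => ?_
  unfold totalCost
  split_ifs
  · exact le_top
  · exact ENNReal.sum_le_tsum _

end SSP

/-! ### Stochastic shortest path instances with two states -/

/-- The probability of not yet being at the goal is the general term of the convergent series that
defines the hitting time. -/
lemma SSP.isProper_of_hittingTime_ne_top {S A : Type} [Fintype S] (M : SSP S A) (π : S → A)
    (h : ∀ s, M.hittingTime π s ≠ ⊤) : M.IsProper π := by
  intro s
  have h0 := ENNReal.tendsto_atTop_zero_of_tsum_ne_top (h s)
  have h1 : ∀ n, M.stateLaw π s n none = 1 - ∑ x, M.stateLaw π s n (some x) := fun n => by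
    have := (M.stateLaw π s n).tsum_coe
    rw [tsum_fintype, Fintype.sum_option] at this
    exact ENNReal.eq_sub_of_add_eq (ne_top_of_le_ne_top ENNReal.one_ne_top
      (this ▸ le_add_self)) this
  simp only [h1]
  simpa using ENNReal.Tendsto.sub (tendsto_const_nhds (x := (1 : ℝ≥0∞))) h0
    (Or.inl ENNReal.one_ne_top)

lemma PMF.tsum_bind_mul {α β : Type} (p : PMF α) (f : α → PMF β) (F : β → ℝ≥0∞) :
    ∑' x, p.bind f x * F x = ∑' a, p a * ∑' x, f a x * F x := by
  simp only [PMF.bind_apply, ← ENNReal.tsum_mul_left, ← ENNReal.tsum_mul_right, mul_assoc]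
  exact ENNReal.tsum_comm

lemma PMF.tsum_map_mul {α β : Type} (p : PMF α) (f : α → β) (F : β → ℝ≥0∞) :
    ∑' x, p.map f x * F x = ∑' a, p a * F (f a) := by
  rw [← PMF.bind_pure_comp, PMF.tsum_bind_mul]
  simp

lemma PMF.lintegral_toMeasure {α : Type} [MeasurableSpace α] [DiscreteMeasurableSpace α]
    [Countable α] (p : PMF α) (F : α → ℝ≥0∞) :
    ∫⁻ x, F x ∂p.toMeasure = ∑' x, p x * F x := by
  rw [MeasureTheory.lintegral_countable']
  exact tsum_congr fun x => by
    rw [PMF.toMeasure_apply_singleton _ _ (.singleton x), mul_comm]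

namespace TwoState

variable {A : Type}

/-- Reach the goal with probability `q`, and otherwise move to the state `1`. -/
noncomputable def exitPMF (q : unitInterval) : PMF (Option (Fin 2)) :=
  PMF.ofFintype (fun z => ENNReal.ofReal (z.elim (q : ℝ) fun x => if x = 1 then 1 - q else 0)) (by
    simp [Fintype.sum_option, ← ENNReal.ofReal_add q.2.1 (sub_nonneg.2 q.2.2)])

@[simp] lemma exitPMF_none (q : unitInterval) : exitPMF q none = ENNReal.ofReal q := by
  simp [exitPMF]

@[simp] lemma exitPMF_zero (q : unitInterval) : exitPMF q (some 0) = 0 := by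
  simp [exitPMF]

@[simp] lemma exitPMF_one (q : unitInterval) : exitPMF q (some 1) = ENNReal.ofReal (1 - q) := by
  simp [exitPMF]

/-- The instance with costs `0` in the initial state `0` and `1` in the state `1`, in which an
action `a` in the state `s` leads to the goal with probability `e s a`, and otherwise to `1`. -/
noncomputable def ssp (e : Fin 2 → A → unitInterval) : SSP (Fin 2) A where
  init := 0
  cost s _ := if s = 1 then 1 else 0
  cost_nonneg s _ := by split_ifs <;> norm_num
  cost_le_one s _ := by split_ifs <;> norm_num
  trans s a := exitPMF (e s a)

variable (e : Fin 2 → A → unitInterval)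

lemma stateLaw_succ_zero (π : Fin 2 → A) (s : Fin 2) (n : ℕ) :
    (ssp e).stateLaw π s (n + 1) (some 0) = 0 := by
  simp [SSP.stateLaw, PMF.bind_apply, tsum_fintype, Fintype.sum_option, ssp]

lemma stateLaw_succ_one (π : Fin 2 → A) (s : Fin 2) (n : ℕ) :
    (ssp e).stateLaw π s (n + 1) (some 1) =
      (ssp e).stateLaw π s n (some 0) * ENNReal.ofReal (1 - e 0 (π 0)) +
      (ssp e).stateLaw π s n (some 1) * ENNReal.ofReal (1 - e 1 (π 1)) := by
  simp [SSP.stateLaw, PMF.bind_apply, tsum_fintype, Fintype.sum_option, ssp]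

lemma stateLaw_one_zero (π : Fin 2 → A) (n : ℕ) : (ssp e).stateLaw π 1 n (some 0) = 0 := by
  cases n with
  | zero => simp [SSP.stateLaw]
  | succ n => exact stateLaw_succ_zero e π 1 n

lemma stateLaw_one_one (π : Fin 2 → A) (n : ℕ) :
    (ssp e).stateLaw π 1 n (some 1) = ENNReal.ofReal (1 - e 1 (π 1)) ^ n := by
  induction n with
  | zero => simp [SSP.stateLaw]
  | succ n ih => rw [stateLaw_succ_one, stateLaw_one_zero, ih, pow_succ]; simp

lemma stateLaw_zero_succ_one (π : Fin 2 → A) (n : ℕ) :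
    (ssp e).stateLaw π 0 (n + 1) (some 1) =
      ENNReal.ofReal (1 - e 0 (π 0)) * ENNReal.ofReal (1 - e 1 (π 1)) ^ n := by
  induction n with
  | zero => rw [stateLaw_succ_one]; simp [SSP.stateLaw]
  | succ n ih => rw [stateLaw_succ_one, ih, stateLaw_succ_zero, pow_succ]; ring

/-! ### Values, hitting times and gaps when state `1` is left with probability `1/B`. -/

variable {e} {B : ℝ}

lemma tsum_geometric_exit (hB : 1 < B) {q : unitInterval} (hq : (q : ℝ) = 1 / B) :
    ∑' n, ENNReal.ofReal (1 - q) ^ n = ENNReal.ofReal B := by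
  rw [ENNReal.tsum_geometric, ← ENNReal.ofReal_one,
    ← ENNReal.ofReal_sub _ (sub_nonneg.2 q.2.2), sub_sub_cancel, hq, one_div,
    ENNReal.ofReal_inv_of_pos (by linarith), inv_inv]

lemma tsum_stateLaw_one (hB : 1 < B) (he : ∀ a, (e 1 a : ℝ) = 1 / B) (π : Fin 2 → A) :
    ∑' n, (ssp e).stateLaw π 1 n (some 1) = ENNReal.ofReal B := by
  simp only [stateLaw_one_one]
  exact tsum_geometric_exit hB (he _)

lemma tsum_stateLaw_zero (hB : 1 < B) (he : ∀ a, (e 1 a : ℝ) = 1 / B) (π : Fin 2 → A) :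
    ∑' n, (ssp e).stateLaw π 0 n (some 1) = ENNReal.ofReal ((1 - e 0 (π 0)) * B) := by
  rw [tsum_eq_zero_add' ENNReal.summable]
  simp only [stateLaw_zero_succ_one]
  rw [ENNReal.tsum_mul_left, tsum_geometric_exit hB (he _),
    ENNReal.ofReal_mul (sub_nonneg.2 (e 0 (π 0)).2.2)]
  simp [SSP.stateLaw]

lemma hittingTime_one (hB : 1 < B) (he : ∀ a, (e 1 a : ℝ) = 1 / B) (π : Fin 2 → A) :
    (ssp e).hittingTime π 1 = ENNReal.ofReal B := by
  simp only [SSP.hittingTime, Fin.sum_univ_two, stateLaw_one_zero, zero_add]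
  exact tsum_stateLaw_one hB he π

lemma hittingTime_zero (hB : 1 < B) (he : ∀ a, (e 1 a : ℝ) = 1 / B) (π : Fin 2 → A) :
    (ssp e).hittingTime π 0 = 1 + ENNReal.ofReal ((1 - e 0 (π 0)) * B) := by
  simp only [SSP.hittingTime, Fin.sum_univ_two]
  rw [ENNReal.tsum_add, tsum_stateLaw_zero hB he, tsum_eq_zero_add' ENNReal.summable]
  simp only [stateLaw_succ_zero]
  simp [SSP.stateLaw]

lemma value_one (hB : 1 < B) (he : ∀ a, (e 1 a : ℝ) = 1 / B) (π : Fin 2 → A) :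
    (ssp e).value π 1 = ENNReal.ofReal B := by
  rw [← tsum_stateLaw_one hB he π]
  simp [SSP.value, Fin.sum_univ_two, ssp]

lemma value_zero (hB : 1 < B) (he : ∀ a, (e 1 a : ℝ) = 1 / B) (π : Fin 2 → A) :
    (ssp e).value π 0 = ENNReal.ofReal ((1 - e 0 (π 0)) * B) := by
  rw [← tsum_stateLaw_zero hB he π]
  simp [SSP.value, Fin.sum_univ_two, ssp]

lemma isProper (hB : 1 < B) (he : ∀ a, (e 1 a : ℝ) = 1 / B) (π : Fin 2 → A) :
    (ssp e).IsProper π := by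
  refine SSP.isProper_of_hittingTime_ne_top _ _ (Fin.forall_fin_two.2 ⟨?_, ?_⟩)
  · simp [hittingTime_zero hB he]
  · simp [hittingTime_one hB he]

lemma optValue_one [Nonempty A] (hB : 1 < B) (he : ∀ a, (e 1 a : ℝ) = 1 / B) :
    (ssp e).optValue 1 = ENNReal.ofReal B := by
  simp [SSP.optValue, isProper hB he, value_one hB he]

lemma optValue_zero (hB : 1 < B) (he : ∀ a, (e 1 a : ℝ) = 1 / B) {w : A}
    (hw : ∀ a, e 0 a ≤ e 0 w) :
    (ssp e).optValue 0 = ENNReal.ofReal ((1 - e 0 w) * B) := by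
  refine le_antisymm ?_ (le_iInf₂ fun π _ => ?_)
  · exact (iInf₂_le (fun _ => w) (isProper hB he _)).trans_eq (value_zero hB he _)
  · rw [value_zero hB he]
    have : (e 0 (π 0) : ℝ) ≤ e 0 w := hw _
    exact ENNReal.ofReal_le_ofReal (mul_le_mul_of_nonneg_right (by linarith) (by linarith))

lemma isOptimal (hB : 1 < B) (he : ∀ a, (e 1 a : ℝ) = 1 / B) {w : A}
    (hw : ∀ a, e 0 a ≤ e 0 w) : (ssp e).IsOptimal fun _ => w := by
  have : Nonempty A := ⟨w⟩
  refine ⟨isProper hB he _, Fin.forall_fin_two.2 ⟨?_, ?_⟩⟩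
  · rw [value_zero hB he, optValue_zero hB he hw]
  · rw [value_one hB he, optValue_one hB he]

lemma iSup_fin_two {f : Fin 2 → ℝ≥0∞} : ⨆ s, f s = max (f 0) (f 1) :=
  le_antisymm (iSup_le (Fin.forall_fin_two.2 ⟨le_max_left _ _, le_max_right _ _⟩))
    (max_le (le_iSup f 0) (le_iSup f 1))

lemma Bstar_eq (hB : 1 < B) (he : ∀ a, (e 1 a : ℝ) = 1 / B) {w : A}
    (hw : ∀ a, e 0 a ≤ e 0 w) : (ssp e).Bstar = ENNReal.ofReal B := by
  have : Nonempty A := ⟨w⟩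
  rw [SSP.Bstar, iSup_fin_two, optValue_zero hB he hw, optValue_one hB he]
  refine max_eq_right (ENNReal.ofReal_le_ofReal ?_)
  nlinarith [(e 0 w).2.1]

lemma gap_zero (hB : 1 < B) (he : ∀ a, (e 1 a : ℝ) = 1 / B) {w : A}
    (hw : ∀ a, e 0 a ≤ e 0 w) (a : A) : (ssp e).gap 0 a = (e 0 w - e 0 a) * B := by
  have : Nonempty A := ⟨w⟩
  have h1 : (0 : ℝ) ≤ (1 - e 0 w) * B := mul_nonneg (sub_nonneg.2 (e 0 w).2.2) (by linarith)
  have h2 : (0 : ℝ) ≤ 1 - e 0 a := sub_nonneg.2 (e 0 a).2.2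
  rw [SSP.gap, SSP.optQ, Fin.sum_univ_two, optValue_zero hB he hw, optValue_one hB he]
  simp only [ssp, exitPMF_zero, exitPMF_one, ENNReal.toReal_ofReal h1, ENNReal.toReal_ofReal h2,
    ENNReal.toReal_ofReal (zero_le_one.trans hB.le)]
  simp
  ring

lemma gap_one (hB : 1 < B) (he : ∀ a, (e 1 a : ℝ) = 1 / B) {w : A}
    (hw : ∀ a, e 0 a ≤ e 0 w) (a : A) : (ssp e).gap 1 a = 0 := by
  have : Nonempty A := ⟨w⟩
  have h2 : (0 : ℝ) ≤ 1 - e 1 a := sub_nonneg.2 (e 1 a).2.2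
  rw [SSP.gap, SSP.optQ, Fin.sum_univ_two, optValue_zero hB he hw, optValue_one hB he]
  simp only [ssp, exitPMF_zero, exitPMF_one, ENNReal.toReal_ofReal h2,
    ENNReal.toReal_ofReal (zero_le_one.trans hB.le)]
  have : B ≠ 0 := by linarith
  simp [he]
  field_simp
  ring

/-! ### Expectations under the law of a learner -/

section Learner

variable (e) (L : Learner (Fin 2) A)

/-- The probability that the learner plays `a` after the history `h`. -/
noncomputable def play (h : List (Transition (Fin 2) A)) (a : A) : ℝ := (L h (curr h) a).toReal

lemma play_nonneg (h : List (Transition (Fin 2) A)) (a : A) : 0 ≤ play L h a :=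
  ENNReal.toReal_nonneg

lemma ofReal_play (h : List (Transition (Fin 2) A)) (a : A) :
    ENNReal.ofReal (play L h a) = L h (curr h) a :=
  ENNReal.ofReal_toReal (PMF.apply_ne_top _ _)

variable [Fintype A]

lemma sum_play (h : List (Transition (Fin 2) A)) : ∑ a, play L h a = 1 := by
  have := (L h (curr h)).tsum_coe
  rw [tsum_fintype] at this
  simp only [play]
  rw [← ENNReal.toReal_sum fun a _ => PMF.apply_ne_top _ _, this, ENNReal.toReal_one]

lemma lintegral_stepLaw (h : List (Transition (Fin 2) A)) (F : Transition (Fin 2) A → ℝ≥0∞) :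
    ∫⁻ x, F x ∂((ssp e).stepLaw L h).toMeasure = ∑ a, L h (curr h) a *
      (ENNReal.ofReal (e (curr h) a) * F ⟨curr h, a, none⟩ +
        ENNReal.ofReal (1 - e (curr h) a) * F ⟨curr h, a, some 1⟩) := by
  have hc : (ssp e).currentState h = curr h := rfl
  rw [PMF.lintegral_toMeasure, SSP.stepLaw, PMF.tsum_bind_mul, hc, tsum_fintype]
  refine Finset.sum_congr rfl fun a _ => ?_
  rw [PMF.tsum_map_mul, tsum_fintype, Fintype.sum_option, Fin.sum_univ_two]
  simp [ssp]

lemma stepMean_ofReal {f : List (Transition (Fin 2) A) → ℝ} (hf : ∀ h, 0 ≤ f h)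
    (h : List (Transition (Fin 2) A)) :
    (ssp e).stepMean L (fun h => ENNReal.ofReal (f h)) h =
      ENNReal.ofReal (avg (play L) (fun s a => e s a) (fun s a => 1 - e s a) f h) := by
  have h1 : ∀ s a, (0 : ℝ) ≤ 1 - e s a := fun s a => sub_nonneg.2 (e s a).2.2
  have h0 : ∀ s a, (0 : ℝ) ≤ e s a := fun s a => (e s a).2.1
  rw [SSP.stepMean, lintegral_stepLaw, avg, ENNReal.ofReal_sum_of_nonneg fun a _ =>
    mul_nonneg (play_nonneg L h a)
      (add_nonneg (mul_nonneg (h0 _ _) (hf _)) (mul_nonneg (h1 _ _) (hf _)))]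
  refine Finset.sum_congr rfl fun a _ => ?_
  rw [ENNReal.ofReal_mul (play_nonneg L h a), ofReal_play,
    ENNReal.ofReal_add (mul_nonneg (h0 _ _) (hf _)) (mul_nonneg (h1 _ _) (hf _)),
    ENNReal.ofReal_mul (h0 _ _), ENNReal.ofReal_mul (h1 _ _)]
  rfl

lemma runningMean_ofReal {g : List (Transition (Fin 2) A) → ℝ} (hg : ∀ h, 0 ≤ g h) (n : ℕ)
    (h : List (Transition (Fin 2) A)) :
    (ssp e).runningMean L (fun h => ENNReal.ofReal (g h)) n h =
      ENNReal.ofReal (total (play L) (fun s a => e s a) (fun s a => 1 - e s a) g n h) := by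
  have h1 : ∀ s a, (0 : ℝ) ≤ 1 - e s a := fun s a => sub_nonneg.2 (e s a).2.2
  have h0 : ∀ s a, (0 : ℝ) ≤ e s a := fun s a => (e s a).2.1
  have ht := total_nonneg (play_nonneg L) h0 h1 hg
  induction n generalizing h with
  | zero => simp [SSP.runningMean, total]
  | succ n ih =>
    have : (ssp e).runningMean L (fun h => ENNReal.ofReal (g h)) n = _ := funext ih
    rw [SSP.runningMean, this, stepMean_ofReal e L (ht n), total, ENNReal.ofReal_add (hg h)]
    exact Finset.sum_nonneg fun a _ => mul_nonneg (play_nonneg L h a)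
      (add_nonneg (mul_nonneg (h0 _ _) (ht _ _)) (mul_nonneg (h1 _ _) (ht _ _)))

/-- The cost of the next step, counted while fewer than `K` episodes are finished. -/
noncomputable def stepCost (K : ℕ) (h : List (Transition (Fin 2) A)) : ℝ :=
  if goals h < K ∧ curr h = 1 then 1 else 0

lemma meanCost_eq (K : ℕ) (h : List (Transition (Fin 2) A)) :
    (ssp e).meanCost L K h = ENNReal.ofReal (stepCost K h) := by
  have h1 : ∀ a, ENNReal.ofReal (e (curr h) a) + ENNReal.ofReal (1 - e (curr h) a) = 1 := by
    intro a
    rw [← ENNReal.ofReal_add (e _ a).2.1 (sub_nonneg.2 (e _ a).2.2)]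
    simp
  have h2 := (L h (curr h)).tsum_coe
  rw [tsum_fintype] at h2
  rw [SSP.meanCost, lintegral_stepLaw]
  simp only [← add_mul, h1, one_mul, ← Finset.sum_mul, h2, stepCost, goals, ssp]
  by_cases hK : h.countP (fun x => x.next.isNone) < K <;> by_cases hc : curr h = 1 <;>
    simp [hK, hc]

lemma total_stepCost_le (K n : ℕ) :
    ENNReal.ofReal (total (play L) (fun s a => e s a) (fun s a => 1 - e s a) (stepCost K) n []) ≤
      ∫⁻ ω, (ssp e).totalCost K ω ∂((ssp e).law L) := by
  rw [← runningMean_ofReal e L (fun h => by unfold stepCost; split_ifs <;> norm_num)]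
  simp only [← meanCost_eq e L]
  exact (ssp e).runningMean_meanCost_le L K n

end Learner

end TwoState

namespace TwoState

/-! ### Visits to the initial state and regret -/

section Visits

variable {A : Type}

/-- The visit to the initial state that takes place now, in the first `K` episodes. -/
noncomputable def visit (K : ℕ) (h : List (Transition (Fin 2) A)) : ℝ :=
  if goals h < K ∧ curr h = 0 then 1 else 0

/-- The number of visits to the initial state from now on, in the first `K` episodes. -/
noncomputable def visitsLeft (K : ℕ) (h : List (Transition (Fin 2) A)) : ℝ :=
  visit K h + (K - 1 - goals h : ℕ)

lemma visit_nonneg (K : ℕ) (h : List (Transition (Fin 2) A)) : 0 ≤ visit K h := by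
  unfold visit; split_ifs <;> norm_num

lemma stepCost_le_one (K : ℕ) (h : List (Transition (Fin 2) A)) : stepCost K h ≤ 1 := by
  unfold stepCost; split_ifs <;> norm_num

lemma visitsLeft_nil {K : ℕ} (hK : 0 < K) :
    visitsLeft K ([] : List (Transition (Fin 2) A)) = K := by
  simp [visitsLeft, visit, hK, Nat.cast_sub (Nat.one_le_iff_ne_zero.2 hK.ne')]

/-- A new episode opens with a visit, which offsets the episode just finished; past the last one,
truncated subtraction gives zero. The value agrees with `visitsLeft_stay`, so `avg` sees only the
total mass of a step. -/
lemma visitsLeft_exit (K : ℕ) (h : List (Transition (Fin 2) A)) (a : A) :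
    visitsLeft K (exit h a) = (K - 1 - goals h : ℕ) := by
  simp only [visitsLeft, visit, goals_exit, curr_exit, and_true]
  split_ifs with hK
  · rw [show K - 1 - goals h = K - 1 - (goals h + 1) + 1 by omega]
    push_cast
    ring
  · rw [show K - 1 - goals h = K - 1 - (goals h + 1) by omega]
    ring

lemma visitsLeft_stay (K : ℕ) (h : List (Transition (Fin 2) A)) (a : A) :
    visitsLeft K (stay h a) = (K - 1 - goals h : ℕ) := by
  simp [visitsLeft, visit]

lemma visitsLeft_nonneg (K : ℕ) (h : List (Transition (Fin 2) A)) : 0 ≤ visitsLeft K h :=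
  add_nonneg (visit_nonneg K h) (Nat.cast_nonneg _)

lemma visitsLeft_le (K : ℕ) (h : List (Transition (Fin 2) A)) : visitsLeft K h ≤ K := by
  unfold visitsLeft visit
  split_ifs with hK
  · have : 1 + (K - 1 - goals h) ≤ K := by omega
    exact_mod_cast this
  · have : K - 1 - goals h ≤ K := by omega
    rw [zero_add]
    exact_mod_cast this

lemma visitsLeft_eq_zero {K : ℕ} {h : List (Transition (Fin 2) A)} (hK : K ≤ goals h) :
    visitsLeft K h = 0 := by
  simp [visitsLeft, visit, not_lt.2 hK, show K - 1 - goals h = 0 by omega]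

lemma stepCost_eq_zero {K : ℕ} {h : List (Transition (Fin 2) A)} (hK : K ≤ goals h) :
    stepCost K h = 0 := by
  simp [stepCost, not_lt.2 hK]

/-- The factor `2 ^ K` outweighs the power of `1/2` until `K` episodes are finished. This feeds
`le_total_of_subharmonic`. -/
lemma le_goals_pow {K : ℕ} {p : List (Transition (Fin 2) A) → ℝ} {C : ℝ} (hC : 0 ≤ C)
    (hp : ∀ h, p h ≤ C) (hp0 : ∀ h, K ≤ goals h → p h = 0) (h : List (Transition (Fin 2) A)) :
    p h ≤ C * 2 ^ K * (1 / 2) ^ goals h := by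
  rcases le_or_gt K (goals h) with hK | hK
  · rw [hp0 h hK]
    positivity
  · refine (hp h).trans ?_
    rw [mul_assoc]
    refine le_mul_of_one_le_right hC ?_
    rw [one_div, inv_pow, ← div_eq_mul_inv, one_le_div (by positivity)]
    exact pow_le_pow_right₀ one_le_two hK.le

variable [Fintype A] {l : List (Transition (Fin 2) A) → A → ℝ} {u v : Fin 2 → A → ℝ}

lemma avg_visitsLeft (K : ℕ) (h : List (Transition (Fin 2) A)) :
    avg l u v (visitsLeft K) h =
      (∑ a, l h a * (u (curr h) a + v (curr h) a)) * (K - 1 - goals h : ℕ) := by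
  simp only [avg, visitsLeft_exit, visitsLeft_stay, ← add_mul, ← mul_assoc, ← Finset.sum_mul]

lemma total_visit_le (hl : ∀ h a, 0 ≤ l h a) (hl1 : ∀ h, ∑ a, l h a = 1)
    (hu : ∀ s a, 0 ≤ u s a) (hv : ∀ s a, 0 ≤ v s a) (huv : ∀ s a, u s a + v s a ≤ 1)
    {K : ℕ} (hK : 0 < K) (n : ℕ) : total l u v (visit K) n [] ≤ K := by
  rw [← visitsLeft_nil (A := A) hK]
  refine total_le_of_superharmonic hl hu hv (visitsLeft_nonneg K) (fun h => ?_) n _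
  rw [avg_visitsLeft, visitsLeft]
  have : ∑ a, l h a * (u (curr h) a + v (curr h) a) ≤ 1 := by
    rw [← hl1 h]
    exact Finset.sum_le_sum fun a _ => mul_le_of_le_one_right (hl h a) (huv _ _)
  gcongr
  exact mul_le_of_le_one_left (Nat.cast_nonneg _) this

/-- Meant for the affinity kernel, which loses mass. With the potential `visitsLeft / 2`, a visit
collects `1` and uses up `1/2`; the spare half covers the lost mass, at most `1/(2K)`, times the
potential of at most `K` later visits. The state `1` loses no mass. -/
lemma le_total_visit (hl : ∀ h a, 0 ≤ l h a) (hl1 : ∀ h, ∑ a, l h a = 1)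
    (hu : ∀ s a, 0 ≤ u s a) (hv : ∀ s a, 0 ≤ v s a) (huv : ∀ s a, u s a + v s a ≤ 1)
    {r : ℝ} (hr : r ≤ 1) (hur : ∀ s a, r ≤ u s a) (h1 : ∀ a, u 1 a + v 1 a = 1)
    {K : ℕ} (hK : 0 < K) (h0 : ∀ a, 1 - 1 / (2 * K) ≤ u 0 a + v 0 a) (n : ℕ) :
    (K : ℝ) / 2 ≤ total l u v (visit K) n [] + K * 2 ^ K * (1 - r / 2) ^ n := by
  have hK' : (0 : ℝ) < K := Nat.cast_pos.2 hK
  have := le_total_of_subharmonic hl hl1 hu hv hr hur huv (g := visit K)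
    (p := fun h => 1 / 2 * visitsLeft K h) (C := K * 2 ^ K) (by positivity)
    (le_goals_pow hK'.le (fun h => by linarith [visitsLeft_le K h, visitsLeft_nonneg K h])
      fun h hh => by rw [visitsLeft_eq_zero hh, mul_zero]) (fun h => ?_) n []
  · simp only [visitsLeft_nil hK, goals_nil, pow_zero, mul_one] at this
    linarith
  · rw [avg_const_mul, avg_visitsLeft, visitsLeft]
    have hm : ((K - 1 - goals h : ℕ) : ℝ) ≤ K := by
      exact_mod_cast (by omega : K - 1 - goals h ≤ K)
    set m : ℝ := ((K - 1 - goals h : ℕ) : ℝ) with hm_def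
    have hm0 : 0 ≤ m := Nat.cast_nonneg _
    rcases (by omega : curr h = 0 ∨ curr h = 1) with hc | hc
    · rw [hc]
      by_cases hh : goals h < K
      · have hs : 1 - 1 / (2 * K) ≤ ∑ a, l h a * (u 0 a + v 0 a) := by
          calc 1 - 1 / (2 * (K : ℝ)) = ∑ a, l h a * (1 - 1 / (2 * K)) := by
                rw [← Finset.sum_mul, hl1, one_mul]
            _ ≤ _ := Finset.sum_le_sum fun a _ => mul_le_mul_of_nonneg_left (h0 a) (hl h a)
        have h3 := mul_le_mul_of_nonneg_right hs hm0
        have h4 : 1 / (2 * (K : ℝ)) * m ≤ 1 / 2 := by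
          rw [div_mul_eq_mul_div, div_le_div_iff₀ (by positivity) two_pos]
          linarith
        have h5 : visit K h = 1 := by simp [visit, hh, hc]
        rw [h5]
        linarith
      · have h5 : m = 0 := by
          rw [hm_def, show K - 1 - goals h = 0 by omega, Nat.cast_zero]
        have h6 : visit K h = 0 := by simp [visit, hh]
        rw [h5, h6]
        simp
    · have h5 : visit K h = 0 := by simp [visit, hc]
      rw [hc, h5]
      simp [h1, hl1]

/-- The regret decomposition: the expected cost exceeds `K * V` by the accumulated gaps. -/
lemma le_total_stepCost (hl : ∀ h a, 0 ≤ l h a) (hl1 : ∀ h, ∑ a, l h a = 1)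
    (e : Fin 2 → A → unitInterval) {B V : ℝ} (hB : 1 < B) (hV : 0 ≤ V)
    (he : ∀ a, (e 1 a : ℝ) = 1 / B) {r : ℝ} (hr : r ≤ 1) (her : ∀ s a, r ≤ e s a)
    {K : ℕ} (hK : 0 < K) (n : ℕ) :
    K * V + total l (fun s a => e s a) (fun s a => 1 - e s a)
        (fun h => visit K h * ∑ a, l h a * ((1 - e 0 a) * B - V)) n [] ≤
      total l (fun s a => e s a) (fun s a => 1 - e s a) (stepCost K) n [] +
        (V * K + B) * 2 ^ K * (1 - r / 2) ^ n := by
  have hB0 : 0 < B := by linarith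
  -- The potential charges `V` for each visit to come and `B` for a current stay in the state `1`.
  -- It balances cost minus gap exactly, for any `V`.
  have := le_total_of_subharmonic (u := fun s a => (e s a : ℝ)) (v := fun s a => 1 - e s a)
    hl hl1 (fun s a => (e s a).2.1)
    (fun s a => sub_nonneg.2 (e s a).2.2) hr her (fun s a => by simp)
    (g := fun h => stepCost K h + -1 * (visit K h * ∑ a, l h a * ((1 - e 0 a) * B - V)))
    (p := fun h => V * visitsLeft K h + B * stepCost K h) (C := (V * K + B) * 2 ^ K)
    (by positivity)
    (le_goals_pow (by positivity) (fun h => add_le_add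
      (mul_le_mul_of_nonneg_left (visitsLeft_le K h) hV)
        (mul_le_of_le_one_right hB0.le (stepCost_le_one K h)))
      fun h hh => by rw [visitsLeft_eq_zero hh, stepCost_eq_zero hh]; ring)
    (fun h => le_of_eq ?_) n []
  · rw [total_add, total_const_mul] at this
    have h0 : stepCost K ([] : List (Transition (Fin 2) A)) = 0 := by simp [stepCost]
    simp only [visitsLeft_nil hK, goals_nil, pow_zero, mul_one, h0, mul_zero, add_zero] at this
    linarith
  · rw [avg_add, avg_const_mul, avg_const_mul, avg_visitsLeft]
    have h2 : ∑ a, l h a * ((e (curr h) a : ℝ) + (1 - e (curr h) a)) = 1 := by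
      simp [hl1]
    rw [h2]
    have h3 : avg l (fun s a => (e s a : ℝ)) (fun s a => 1 - (e s a : ℝ)) (stepCost K) h =
        if goals h < K then ∑ a, l h a * (1 - e (curr h) a) else 0 := by
      simp only [avg, stepCost, curr_exit, curr_stay, goals_stay, zero_ne_one, and_false, if_false,
        mul_zero, zero_add, and_true]
      split_ifs <;> simp
    rw [h3, visitsLeft]
    by_cases hh : goals h < K
    · rcases (by omega : curr h = 0 ∨ curr h = 1) with hc | hc
      · have h4 : ∑ a, l h a * ((1 - (e 0 a : ℝ)) * B - V) =
            (∑ a, l h a * (1 - (e 0 a : ℝ))) * B - V := by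
          simp only [mul_sub, Finset.sum_sub_distrib, ← Finset.sum_mul, hl1, ← mul_assoc, one_mul]
        rw [h4]
        simp only [visit, stepCost, hh, hc]
        simp
        ring
      · simp only [visit, stepCost, hh, hc, he, ← Finset.sum_mul, hl1]
        simp
        field_simp
        ring
    · simp [visit, stepCost, hh]

end Visits

/-! ### The hypercube -/

section Hypercube

variable {d : ℕ}

/-- The inner product of two points of the hypercube `{-1, 1}^d`. -/
def dot (a w : Fin d → ℤˣ) : ℝ := ∑ i, ((a i : ℤ) : ℝ) * ((w i : ℤ) : ℝ)

lemma units_mul_eq_ite (x y : ℤˣ) :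
    ((x : ℤ) : ℝ) * ((y : ℤ) : ℝ) = 1 - 2 * if x = y then 0 else 1 := by
  rcases Int.units_eq_one_or x with rfl | rfl <;> rcases Int.units_eq_one_or y with rfl | rfl <;>
    norm_num [show (1 : ℤˣ) ≠ -1 by decide, show (-1 : ℤˣ) ≠ 1 by decide]

lemma dot_eq (a w : Fin d → ℤˣ) : dot a w = d - 2 * ∑ i, if a i = w i then (0 : ℝ) else 1 := by
  simp [dot, units_mul_eq_ite, Finset.mul_sum]

lemma dot_self (w : Fin d → ℤˣ) : dot w w = d := by simp [dot_eq]

lemma dot_le (a w : Fin d → ℤˣ) : dot a w ≤ d := by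
  rw [dot_eq, sub_le_self_iff]
  exact mul_nonneg two_pos.le (Finset.sum_nonneg fun i _ => by split_ifs <;> norm_num)

lemma neg_le_dot (a w : Fin d → ℤˣ) : -(d : ℝ) ≤ dot a w := by
  have : ∑ i, (if a i = w i then (0 : ℝ) else 1) ≤ ∑ _i : Fin d, 1 :=
    Finset.sum_le_sum fun i _ => by split_ifs <;> norm_num
  rw [dot_eq]
  simp at this
  linarith

/-- The point `w` with its coordinate `i` negated. -/
def flip (i : Fin d) (w : Fin d → ℤˣ) : Fin d → ℤˣ := Function.update w i (-w i)

lemma flip_flip (i : Fin d) : Function.Involutive (flip i) := fun w => by simp [flip]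

lemma dot_sub_dot_flip (i : Fin d) (a w : Fin d → ℤˣ) :
    dot a w - dot a (flip i w) = 2 * (((a i : ℤ) : ℝ) * ((w i : ℤ) : ℝ)) := by
  rw [dot, dot, ← Finset.sum_sub_distrib, Finset.sum_eq_single i]
  · simp [flip]
    ring
  · intro j _ hj
    simp [flip, hj]
  · simp

lemma dot_flip_sq (i : Fin d) (a w : Fin d → ℤˣ) : (dot a w - dot a (flip i w)) ^ 2 = 4 := by
  rw [dot_sub_dot_flip, units_mul_eq_ite]
  split_ifs <;> norm_num

/-- The exit probabilities `1 / 2 + D * ⟨a, w⟩` in the initial state and `1 / B` in the other. -/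
noncomputable def exitProb (D B : ℝ) (w : Fin d → ℤˣ) (s : Fin 2) (a : Fin d → ℤˣ) :
    unitInterval :=
  Set.projIcc 0 1 zero_le_one (if s = 0 then 1 / 2 + D * dot a w else 1 / B)

variable {D B : ℝ}

lemma exitProb_one (hB : 1 < B) (w a : Fin d → ℤˣ) : (exitProb D B w 1 a : ℝ) = 1 / B := by
  have h : 1 / B ∈ Set.Icc (0 : ℝ) 1 :=
    ⟨by positivity, by rw [div_le_one (by linarith)]; exact hB.le⟩
  simp only [exitProb, one_ne_zero, if_false]
  rw [Set.projIcc_of_mem _ h]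

lemma abs_mul_dot_le (hD : 0 ≤ D) (hd : d * D ≤ 1 / 4) (a w : Fin d → ℤˣ) :
    -(1 / 4) ≤ D * dot a w ∧ D * dot a w ≤ 1 / 4 := by
  have h1 := mul_le_mul_of_nonneg_left (dot_le a w) hD
  have h2 := mul_le_mul_of_nonneg_left (neg_le_dot a w) hD
  constructor <;> linarith

lemma exitProb_zero (hD : 0 ≤ D) (hd : d * D ≤ 1 / 4) (w a : Fin d → ℤˣ) :
    (exitProb D B w 0 a : ℝ) = 1 / 2 + D * dot a w := by
  obtain ⟨h1, h2⟩ := abs_mul_dot_le hD hd a w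
  have h : 1 / 2 + D * dot a w ∈ Set.Icc (0 : ℝ) 1 := ⟨by linarith, by linarith⟩
  simp only [exitProb, if_true]
  rw [Set.projIcc_of_mem _ h]

lemma exitProb_zero_self (hD : 0 ≤ D) (hd : d * D ≤ 1 / 4) (w : Fin d → ℤˣ) :
    (exitProb D B w 0 w : ℝ) = 1 / 2 + d * D := by
  rw [exitProb_zero hD hd, dot_self, mul_comm]

lemma exitProb_le_self (hD : 0 ≤ D) (hd : d * D ≤ 1 / 4) (w a : Fin d → ℤˣ) :
    exitProb D B w 0 a ≤ exitProb D B w 0 w := by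
  rw [← Subtype.coe_le_coe, exitProb_zero hD hd, exitProb_zero hD hd, dot_self]
  linarith [mul_le_mul_of_nonneg_left (dot_le a w) hD]

lemma min_le_exitProb (hB : 1 < B) (hD : 0 ≤ D) (hd : d * D ≤ 1 / 4) (w : Fin d → ℤˣ)
    (s : Fin 2) (a : Fin d → ℤˣ) : min (1 / 4) (1 / B) ≤ (exitProb D B w s a : ℝ) := by
  rcases (by omega : s = 0 ∨ s = 1) with rfl | rfl
  · rw [exitProb_zero hD hd]
    exact (min_le_left _ _).trans (by linarith [abs_mul_dot_le hD hd a w])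
  · rw [exitProb_one hB]
    exact min_le_right _ _

/-- Put `x = (p - q)²`. As `((p + q)/2)² - pq = x/4`, squaring reduces the claim to `x (p + q - 1/4
- x) ≥ 0`. Used for both outcomes, it bounds the affinity loss of a Bernoulli pair by `2x`. -/
lemma sub_sq_le_sqrt_mul {p q : ℝ} (hp : 1 / 4 ≤ p) (hq : 1 / 4 ≤ q) (hp' : p ≤ 3 / 4)
    (hq' : q ≤ 3 / 4) : (p + q) / 2 - (p - q) ^ 2 ≤ √(p * q) := by
  refine Real.le_sqrt_of_sq_le ?_
  have h1 : (p - q) ^ 2 ≤ p + q - 1 / 4 := by nlinarith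
  nlinarith [mul_nonneg (sq_nonneg (p - q)) (sub_nonneg.2 h1)]

lemma sqrt_mul_le_add {p q : ℝ} (hp : 0 ≤ p) (hq : 0 ≤ q) : √(p * q) ≤ (p + q) / 2 :=
  Real.sqrt_le_iff.2 ⟨by linarith, by nlinarith [sq_nonneg (p - q)]⟩

end Hypercube

end TwoState

namespace TwoState

variable {d : ℕ}

/-! ### The lower bound for the hypercube -/

section LowerBound

/-- The probability that the learner's action in a visit to the initial state differs from `w` in
the coordinate `i`. -/
noncomputable def miss (l : List (Transition (Fin 2) (Fin d → ℤˣ)) → (Fin d → ℤˣ) → ℝ) (K : ℕ)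
    (w : Fin d → ℤˣ) (i : Fin d) (h : List (Transition (Fin 2) (Fin d → ℤˣ))) : ℝ :=
  visit K h * ∑ a, l h a * if a i = w i then 0 else 1

/-- The expected number of visits, within `n` steps and `K` episodes, in which the action of the
learner differs from `w` in the coordinate `i`. -/
noncomputable def meanMiss (l : List (Transition (Fin 2) (Fin d → ℤˣ)) → (Fin d → ℤˣ) → ℝ)
    (D B : ℝ) (K n : ℕ) (w : Fin d → ℤˣ) (i : Fin d) : ℝ :=
  total l (fun s a => exitProb D B w s a) (fun s a => 1 - exitProb D B w s a) (miss l K w i) n []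

variable {l : List (Transition (Fin 2) (Fin d → ℤˣ)) → (Fin d → ℤˣ) → ℝ} {D B : ℝ} {K : ℕ}

lemma miss_nonneg (hl : ∀ h a, 0 ≤ l h a) (w : Fin d → ℤˣ) (i : Fin d)
    (h : List (Transition (Fin 2) (Fin d → ℤˣ))) : 0 ≤ miss l K w i h :=
  mul_nonneg (visit_nonneg K h) (Finset.sum_nonneg fun a _ =>
    mul_nonneg (hl h a) (by split_ifs <;> norm_num))

/-- Every action is wrong in the coordinate `i` for exactly one of `w` and `flip i w`. -/
lemma miss_add_miss_flip (hl1 : ∀ h, ∑ a, l h a = 1) (w : Fin d → ℤˣ) (i : Fin d)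
    (h : List (Transition (Fin 2) (Fin d → ℤˣ))) :
    miss l K w i h + miss l K (flip i w) i h = visit K h := by
  have hx : ∀ a : Fin d → ℤˣ, ((if a i = w i then 0 else 1) +
      if a i = flip i w i then 0 else 1 : ℝ) = 1 := fun a => by
    simp only [flip, Function.update_self]
    rcases Int.units_eq_one_or (a i) with h1 | h1 <;>
      rcases Int.units_eq_one_or (w i) with h2 | h2 <;>
      norm_num [h1, h2, show (1 : ℤˣ) ≠ -1 by decide, show (-1 : ℤˣ) ≠ 1 by decide]
  simp only [miss, ← mul_add, ← Finset.sum_add_distrib, hx, mul_one, hl1]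

/-- Apply `two_point` with `c = 1/4`: the affinity kernel sees about `K/2` visits, worth `K/4`, and
each instance sees at most `K`, which costs `2K/16`. -/
lemma meanMiss_add_meanMiss_flip (hl : ∀ h a, 0 ≤ l h a) (hl1 : ∀ h, ∑ a, l h a = 1)
    (hB : 1 < B) (hD : 0 ≤ D) (hd : d * D ≤ 1 / 4) (hK : 0 < K) (hDK : 16 * D ^ 2 * K ≤ 1)
    (n : ℕ) (w : Fin d → ℤˣ) (i : Fin d) :
    (K : ℝ) / 8 - K * 2 ^ K * (1 - min (1 / 4) (1 / B) / 2) ^ n ≤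
      meanMiss l D B K n w i + meanMiss l D B K n (flip i w) i := by
  have hK' : (0 : ℝ) < K := Nat.cast_pos.2 hK
  have e0 : ∀ (w : Fin d → ℤˣ) s a, (0 : ℝ) ≤ exitProb D B w s a := fun w s a => (exitProb D B w s a).2.1
  have e1 : ∀ (w : Fin d → ℤˣ) s a, (0 : ℝ) ≤ 1 - exitProb D B w s a :=
    fun w s a => sub_nonneg.2 (exitProb D B w s a).2.2
  have hr0 : 0 ≤ min (1 / 4) (1 / B) := le_min (by norm_num) (by positivity)
  have h1 := two_point hl (e0 w) (e1 w) (e0 (flip i w)) (e1 (flip i w))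
    (miss_nonneg (K := K) hl w i) (miss_nonneg (K := K) hl (flip i w) i) (1 / 4) n []
  simp only [miss_add_miss_flip hl1] at h1
  have h2 := fun w => total_visit_le hl hl1 (e0 w) (e1 w) (fun s a => by simp) hK n
  have h3 := le_total_visit hl hl1
    (u := fun s a => √(exitProb D B w s a * exitProb D B (flip i w) s a))
    (v := fun s a => √((1 - exitProb D B w s a) * (1 - exitProb D B (flip i w) s a)))
    (fun _ _ => Real.sqrt_nonneg _) (fun _ _ => Real.sqrt_nonneg _)
    (fun s a => by
      linarith [sqrt_mul_le_add (e0 w s a) (e0 (flip i w) s a),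
        sqrt_mul_le_add (e1 w s a) (e1 (flip i w) s a)])
    (r := min (1 / 4) (1 / B)) ((min_le_left _ _).trans (by norm_num))
    (fun s a => by
      refine Real.le_sqrt_of_sq_le ?_
      rw [sq]
      exact mul_le_mul (min_le_exitProb hB hD hd _ _ _) (min_le_exitProb hB hD hd _ _ _) hr0
        (e0 _ _ _))
    (fun a => by
      have := e1 w 1 a
      have := e0 w 1 a
      rw [exitProb_one hB] at *
      rw [exitProb_one hB, Real.sqrt_mul_self (by assumption), Real.sqrt_mul_self (by assumption)]
      ring)
    hK
    (fun a => by
      simp only [exitProb_zero hD hd]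
      obtain ⟨a1, a2⟩ := abs_mul_dot_le hD hd a w
      obtain ⟨b1, b2⟩ := abs_mul_dot_le hD hd a (flip i w)
      have s1 := sub_sq_le_sqrt_mul (p := 1 / 2 + D * dot a w)
        (q := 1 / 2 + D * dot a (flip i w)) (by linarith) (by linarith) (by linarith) (by linarith)
      have s2 := sub_sq_le_sqrt_mul (p := 1 - (1 / 2 + D * dot a w))
        (q := 1 - (1 / 2 + D * dot a (flip i w))) (by linarith) (by linarith) (by linarith)
        (by linarith)
      -- The probabilities differ by `2D` in absolute value, so a visit loses at most `2 · 4D²` of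
      -- mass, within the allowance of `le_total_visit`.
      have h4 : 8 * D ^ 2 ≤ 1 / (2 * K) := by
        rw [le_div_iff₀ (by positivity)]
        linarith
      have h5 : (D * dot a w - D * dot a (flip i w)) ^ 2 = 4 * D ^ 2 := by
        rw [← mul_sub, mul_pow, dot_flip_sq]
        ring
      nlinarith) n
  have h4 := h2 w
  have h5 := h2 (flip i w)
  have h6 : 0 ≤ (K : ℝ) * 2 ^ K * (1 - min (1 / 4) (1 / B) / 2) ^ n :=
    mul_nonneg (by positivity) (pow_nonneg
      (by linarith [min_le_left (1 / 4 : ℝ) (1 / B)]) n)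
  simp only [meanMiss]
  linarith

/-- Since `flip i` permutes the hypercube, the bound for pairs gives half of it for the mean over
`w`, for every `i`. Some `w` reaches the mean of the sum over `i`. -/
lemma exists_le_sum_meanMiss (hl : ∀ h a, 0 ≤ l h a) (hl1 : ∀ h, ∑ a, l h a = 1)
    (hB : 1 < B) (hD : 0 ≤ D) (hd : d * D ≤ 1 / 4) (hK : 0 < K) (hDK : 16 * D ^ 2 * K ≤ 1)
    (n : ℕ) : ∃ w : Fin d → ℤˣ,
      d / 2 * ((K : ℝ) / 8 - K * 2 ^ K * (1 - min (1 / 4) (1 / B) / 2) ^ n) ≤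
        ∑ i, meanMiss l D B K n w i := by
  set c : ℝ := (K : ℝ) / 8 - K * 2 ^ K * (1 - min (1 / 4) (1 / B) / 2) ^ n with hc
  have h1 : ∀ i : Fin d, ∑ _w : Fin d → ℤˣ, c / 2 ≤ ∑ w, meanMiss l D B K n w i := fun i => by
    have h2 : ∑ w, meanMiss l D B K n (flip i w) i = ∑ w, meanMiss l D B K n w i :=
      Equiv.sum_comp (flip_flip i).toPerm fun w => meanMiss l D B K n w i
    have h3 := Finset.sum_le_sum fun w (_ : w ∈ Finset.univ) =>
      meanMiss_add_meanMiss_flip hl hl1 hB hD hd hK hDK n w i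
    rw [Finset.sum_add_distrib, h2, ← hc] at h3
    rw [← Finset.sum_div]
    linarith
  obtain ⟨w, -, hw⟩ := Finset.exists_le_of_sum_le (s := (Finset.univ : Finset (Fin d → ℤˣ)))
    (f := fun _ => ∑ _i : Fin d, c / 2) (g := fun w => ∑ i, meanMiss l D B K n w i)
    Finset.univ_nonempty (by
      rw [Finset.sum_comm, Finset.sum_comm (f := fun w i => meanMiss l D B K n w i)]
      exact Finset.sum_le_sum fun i _ => h1 i)
  refine ⟨w, le_trans (le_of_eq ?_) hw⟩
  simp
  ring

/-- The gap of an action is `2DB` times its Hamming distance to `w`, so the regret decomposition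
splits over coordinates. -/
lemma le_total_stepCost_exitProb (hl : ∀ h a, 0 ≤ l h a) (hl1 : ∀ h, ∑ a, l h a = 1)
    (hB : 1 < B) (hD : 0 ≤ D) (hd : d * D ≤ 1 / 4) (hK : 0 < K) (n : ℕ) (w : Fin d → ℤˣ) :
    K * ((1 / 2 - d * D) * B) + 2 * D * B * ∑ i, meanMiss l D B K n w i ≤
      total l (fun s a => exitProb D B w s a) (fun s a => 1 - exitProb D B w s a)
          (stepCost K) n [] +
        ((1 / 2 - d * D) * B * K + B) * 2 ^ K * (1 - min (1 / 4) (1 / B) / 2) ^ n := by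
  have h := le_total_stepCost hl hl1 (exitProb D B w) hB (V := (1 / 2 - d * D) * B)
    (mul_nonneg (by linarith) (by linarith)) (exitProb_one hB w)
    ((min_le_left _ _).trans (by norm_num)) (min_le_exitProb hB hD hd w) hK n
  refine le_trans (le_of_eq ?_) h
  simp only [meanMiss]
  rw [← total_sum, ← total_const_mul]
  congr 2
  funext h
  simp only [miss, exitProb_zero hD hd, dot_eq, Finset.mul_sum]
  rw [Finset.sum_comm]
  refine Finset.sum_congr rfl fun a _ => ?_
  have : ∀ x : ℝ, visit K h * (l h a * ((1 - (1 / 2 + D * (d - x))) * B - (1 / 2 - d * D) * B)) =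
      D * B * visit K h * l h a * x := fun x => by ring
  rw [this, Finset.mul_sum]
  exact Finset.sum_congr rfl fun i _ => by ring

end LowerBound

/-! ### The linear structure -/

section Linear

/-- The vector with coordinates `x`, `y` and then those of `z`. -/
def block (x y : ℝ) (z : Fin d → ℝ) : EuclideanSpace ℝ (Fin (d + 2)) :=
  WithLp.toLp 2 (Fin.cons x (Fin.cons y z))

lemma inner_block (x y x' y' : ℝ) (z z' : Fin d → ℝ) :
    inner ℝ (block x y z) (block x' y' z') = x * x' + y * y' + ∑ i, z i * z' i := by
  simp [block, PiLp.inner_apply, Fin.sum_univ_succ, mul_comm, add_assoc]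

lemma norm_block_sq (x y : ℝ) (z : Fin d → ℝ) :
    ‖block x y z‖ ^ 2 = x ^ 2 + y ^ 2 + ∑ i, z i ^ 2 := by
  rw [← real_inner_self_eq_norm_sq, inner_block]
  simp only [sq]

lemma smul_block (c x y : ℝ) (z : Fin d → ℝ) :
    c • block x y z = block (c * x) (c * y) fun i => c * z i := by
  ext i
  refine Fin.cases ?_ (fun i => Fin.cases ?_ (fun i => ?_) i) i <;> simp [block]

lemma block_add_block (x y x' y' : ℝ) (z z' : Fin d → ℝ) :
    block x y z + block x' y' z' = block (x + x') (y + y') fun i => z i + z' i := by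
  ext i
  refine Fin.cases ?_ (fun i => Fin.cases ?_ (fun i => ?_) i) i <;> simp [block]

/-- The feature map of the instances on the hypercube. -/
noncomputable def feature (d : ℕ) (s : Fin 2) (a : Fin d → ℤˣ) :
    EuclideanSpace ℝ (Fin (d + 2)) :=
  if s = 1 then block 1 0 0 else block 0 (1 / √2) fun i => ((a i : ℤ) : ℝ) / √(2 * d)

/-- The vectors that represent the transition laws. -/
noncomputable def mass (D B : ℝ) (w : Fin d → ℤˣ) : Option (Fin 2) → EuclideanSpace ℝ (Fin (d + 2))
  | none => block (1 / B) (1 / √2) fun i => D * √(2 * d) * ((w i : ℤ) : ℝ)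
  | some x => if x = 1 then
      block (1 - 1 / B) (1 / √2) fun i => -(D * √(2 * d) * ((w i : ℤ) : ℝ)) else 0

lemma units_cast_sq (x : ℤˣ) : ((x : ℤ) : ℝ) ^ 2 = 1 := by
  rcases Int.units_eq_one_or x with rfl | rfl <;> norm_num

lemma one_div_sqrt_two_mul_self : 1 / √2 * (1 / √2) = (1 / 2 : ℝ) := by
  rw [div_mul_div_comm, Real.mul_self_sqrt two_pos.le, one_mul]

lemma norm_feature_le (hd : 0 < d) (s : Fin 2) (a : Fin d → ℤˣ) : ‖feature d s a‖ ≤ 1 := by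
  have hd' : (0 : ℝ) < d := Nat.cast_pos.2 hd
  rw [← sq_le_one_iff₀ (norm_nonneg _), feature]
  split_ifs
  · simp [norm_block_sq]
  · rw [norm_block_sq, sq (1 / √2), one_div_sqrt_two_mul_self]
    simp only [div_pow, units_cast_sq, Real.sq_sqrt (by positivity : (0 : ℝ) ≤ 2 * d)]
    simp
    field_simp
    norm_num

lemma inner_feature_sum (hd : 0 < d) (D : ℝ) (a w : Fin d → ℤˣ) :
    ∑ i, ((a i : ℤ) : ℝ) / √(2 * d) * (D * √(2 * d) * ((w i : ℤ) : ℝ)) = D * dot a w := by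
  have hs : √(2 * (d : ℝ)) ≠ 0 := by
    have : (0 : ℝ) < d := Nat.cast_pos.2 hd
    positivity
  rw [dot, Finset.mul_sum]
  exact Finset.sum_congr rfl fun i _ => by field_simp

/-- The three blocks add at most `‖h‖²`, `2‖h‖²` and, by `d * D ≤ 1 / 4`, `‖h‖²` to the squared
norm; `d ≥ 2` gives `4 ≤ d + 2`. -/
lemma norm_sum_smul_mass_le {D B : ℝ} (hd : 2 ≤ d) (hB : 1 < B) (hD : 0 ≤ D)
    (hdD : d * D ≤ 1 / 4) (w : Fin d → ℤˣ) (h : Option (Fin 2) → ℝ) :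
    ‖∑ z, h z • mass D B w z‖ ≤ √((d + 2 : ℕ) : ℝ) * ‖h‖ := by
  have hd' : (2 : ℝ) ≤ d := by exact_mod_cast hd
  have hs : ∑ z, h z • mass D B w z =
      block (h none * (1 / B) + h (some 1) * (1 - 1 / B)) ((h none + h (some 1)) * (1 / √2))
        fun i => (h none - h (some 1)) * (D * √(2 * d)) * ((w i : ℤ) : ℝ) := by
    rw [Fintype.sum_option, Fin.sum_univ_two]
    simp only [mass, zero_ne_one, if_false, if_true, smul_zero, zero_add]
    rw [smul_block, smul_block, block_add_block]
    congr 1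
    · ring
    · funext i
      ring
  have h1 : |h none| ≤ ‖h‖ := norm_le_pi_norm h none
  have h2 : |h (some 1)| ≤ ‖h‖ := norm_le_pi_norm h (some 1)
  set N := ‖h‖
  set x := h none
  set y := h (some 1)
  have hN : 0 ≤ N := (abs_nonneg _).trans h1
  have hx := sq_le_sq' (abs_le.1 h1).1 (abs_le.1 h1).2
  have hy := sq_le_sq' (abs_le.1 h2).1 (abs_le.1 h2).2
  have hb0 : 0 ≤ 1 / B := by positivity
  have hb1 : 0 ≤ 1 - 1 / B := by
    rw [sub_nonneg, div_le_one (by linarith)]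
    exact hB.le
  have e1 : (x * (1 / B) + y * (1 - 1 / B)) ^ 2 ≤ N ^ 2 := by
    refine sq_le_sq' ?_ ?_ <;> nlinarith [abs_le.1 h1, abs_le.1 h2]
  have e2 : ((x + y) * (1 / √2)) ^ 2 ≤ 2 * N ^ 2 := by
    rw [mul_pow, sq (1 / √2), one_div_sqrt_two_mul_self]
    nlinarith [sq_nonneg (x - y)]
  have e3 : ∑ i, ((x - y) * (D * √(2 * d)) * ((w i : ℤ) : ℝ)) ^ 2 ≤ N ^ 2 := by
    simp only [mul_pow, units_cast_sq, Real.sq_sqrt (by positivity : (0 : ℝ) ≤ 2 * d), mul_one]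
    simp only [Finset.sum_const, Finset.card_univ, Fintype.card_fin, nsmul_eq_mul]
    have h3 : (x - y) ^ 2 ≤ 4 * N ^ 2 := by nlinarith [sq_nonneg (x + y)]
    have h4 : (d * D) ^ 2 ≤ 1 / 16 := by
      have : 0 ≤ d * D := by positivity
      nlinarith
    have h5 := mul_le_mul h3 h4 (sq_nonneg _) (by positivity)
    nlinarith
  rw [hs]
  refine le_of_sq_le_sq ?_ (by positivity)
  rw [norm_block_sq, mul_pow (√_), Real.sq_sqrt (Nat.cast_nonneg _)]
  push_cast
  nlinarith [sq_nonneg N]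

lemma isLinear {D B : ℝ} (hd : 2 ≤ d) (hB : 1 < B) (hD : 0 ≤ D)
    (hdD : d * D ≤ 1 / 4) (w : Fin d → ℤˣ) :
    (ssp (exitProb D B w)).IsLinear (feature d) (block 1 0 0) := by
  refine ⟨fun s a => ?_, norm_feature_le (by omega), ?_, mass D B w, fun s a z => ?_,
    norm_sum_smul_mass_le hd hB hD hdD w⟩
  · simp only [ssp, feature]
    split_ifs <;> rw [inner_block] <;> simp
  · have h1 : ‖(block 1 0 0 : EuclideanSpace ℝ (Fin (d + 2)))‖ ≤ 1 := by
      rw [← sq_le_one_iff₀ (norm_nonneg _), norm_block_sq]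
      simp
    refine h1.trans (Real.one_le_sqrt.2 ?_)
    push_cast
    linarith [(Nat.cast_nonneg d : (0 : ℝ) ≤ d)]
  · have hq := (exitProb D B w s a).2
    have hz : ((ssp (exitProb D B w)).trans s a z).toReal =
        z.elim (exitProb D B w s a : ℝ) fun x => if x = 1 then 1 - exitProb D B w s a else 0 := by
      rcases z with _ | z
      · simp [ssp, hq.1]
      · rcases (by omega : z = 0 ∨ z = 1) with rfl | rfl
        · simp [ssp]
        · simp only [ssp, exitPMF_one, ENNReal.toReal_ofReal (sub_nonneg.2 hq.2)]
          simp
    rw [hz]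
    have hsum := inner_feature_sum (by omega : 0 < d) D a w
    rcases (by omega : s = 0 ∨ s = 1) with rfl | rfl
    · rw [exitProb_zero hD hdD]
      rcases z with _ | z
      · simp only [feature, mass, zero_ne_one, if_false, inner_block, hsum,
          one_div_sqrt_two_mul_self, Option.elim_none]
        ring
      · rcases (by omega : z = 0 ∨ z = 1) with rfl | rfl
        · simp [mass]
        · simp only [feature, mass, zero_ne_one, if_false, if_true, inner_block, mul_neg,
            Finset.sum_neg_distrib, hsum, one_div_sqrt_two_mul_self, Option.elim_some]
          ring
    · rw [exitProb_one hB]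
      rcases z with _ | z
      · simp [feature, mass, inner_block]
      · rcases (by omega : z = 0 ∨ z = 1) with rfl | rfl
        · simp [mass]
        · simp [feature, mass, inner_block]

/-- All gaps are zero or `2DB` times a Hamming distance, a natural number; flipping one coordinate
of `w` realizes distance one. -/
lemma gapMin_eq {D B : ℝ} (hd : 0 < d) (hB : 1 < B) (hD : 0 < D)
    (hdD : d * D ≤ 1 / 4) (w : Fin d → ℤˣ) :
    (ssp (exitProb D B w)).gapMin = 2 * D * B := by
  have hDB : 0 < 2 * D * B := by positivity
  have hgap : ∀ a, (ssp (exitProb D B w)).gap 0 a =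
      2 * D * B * ((∑ i, if a i = w i then 0 else 1 : ℕ) : ℝ) := fun a => by
    rw [gap_zero hB (exitProb_one hB w) (exitProb_le_self hD.le hdD w),
      exitProb_zero hD.le hdD, exitProb_zero hD.le hdD, dot_self, dot_eq]
    push_cast
    ring
  refine IsLeast.csInf_eq ⟨⟨hDB, 0, flip ⟨0, hd⟩ w, ?_⟩, ?_⟩
  · rw [hgap, Finset.sum_eq_single ⟨0, hd⟩]
    · have : -w ⟨0, hd⟩ ≠ w ⟨0, hd⟩ := by
        rcases Int.units_eq_one_or (w ⟨0, hd⟩) with h | h <;> rw [h] <;> decide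
      simp [flip, this]
    · intro j _ hj
      simp [flip, hj]
    · simp
  · rintro x ⟨hx, s, a, rfl⟩
    rcases (by omega : s = 0 ∨ s = 1) with rfl | rfl
    · rw [hgap] at hx ⊢
      have h1 : (0 : ℝ) < ((∑ i, if a i = w i then 0 else 1 : ℕ) : ℝ) := by
        by_contra hc
        nlinarith
      exact le_mul_of_one_le_right hDB.le (by exact_mod_cast Nat.cast_pos.1 h1)
    · rw [gap_one hB (exitProb_one hB w) (exitProb_le_self hD.le hdD w)] at hx
      exact absurd hx (lt_irrefl _)

end Linear

end TwoState

/-! ### The main theorem: choice of parameters and conclusion. -/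

open TwoState in
theorem mainTheorem4 :
    ∃ c c₁ c₂ : ℝ, 0 < c ∧ 0 < c₁ ∧ 0 < c₂ ∧
      ∀ (d K : ℕ) (B : ℝ), 2 ≤ d → 3 * d ^ 2 ≤ 2 * K → 1 < B →
        ∃ (φ : Fin 2 → (Fin d → ℤˣ) → EuclideanSpace ℝ (Fin (d + 2)))
          (θ : EuclideanSpace ℝ (Fin (d + 2))) (s₀ : Fin 2) (τ : ℝ≥0∞) (γ : ℝ),
          c₁ * (B / √(K : ℝ)) ≤ γ ∧ γ ≤ c₂ * (B / √(K : ℝ)) ∧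
          ∀ L : Learner (Fin 2) (Fin d → ℤˣ), ∃ M : SSP (Fin 2) (Fin d → ℤˣ),
            M.init = s₀ ∧
            M.IsLinear φ θ ∧
            (∃ π, M.IsOptimal π ∧ ⨆ s, M.hittingTime π s = τ) ∧
            M.Bstar = ENNReal.ofReal B ∧
            M.gapMin = γ ∧
            ((c * (d * B ^ 2 / γ) : ℝ) : EReal) ≤ M.expectedRegret L K ∧
            ((c * (B * d * √(K : ℝ)) : ℝ) : EReal) ≤ M.expectedRegret L K := by
  -- With `γ = B/(2√K)` one has `dB²/γ = 2Bd√K`, so `1/128` is exactly what the regret bound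
  -- `Bd√K/64` below allows.
  refine ⟨1 / 128, 1 / 2, 1 / 2, by norm_num, by norm_num, by norm_num,
    fun d K B hd hdK hB => ?_⟩
  have hB0 : 0 < B := by linarith
  have hK : 0 < K := by nlinarith
  have hK' : (1 : ℝ) ≤ K := by exact_mod_cast hK
  have hd' : (2 : ℝ) ≤ d := by exact_mod_cast hd
  set q : ℝ := √(K : ℝ) with hq
  have hqq : q * q = K := Real.mul_self_sqrt (by linarith)
  have hq1 : 1 ≤ q := Real.one_le_sqrt.2 hK'
  have hq0 : 0 < q := by linarith
  have hdq : (d : ℝ) ≤ q := by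
    refine Real.le_sqrt_of_sq_le ?_
    have : d ^ 2 ≤ K := by omega
    exact_mod_cast this
  -- The largest `D` with `16 D² K ≤ 1`; then `d ≤ √K` keeps `d * D ≤ 1/4`.
  set D : ℝ := 1 / (4 * q) with hD_def
  have hD : 0 < D := by positivity
  have hDq : D * q = 1 / 4 := by
    rw [hD_def]
    field_simp
  have hdD : d * D ≤ 1 / 4 := by nlinarith
  have hDK : 16 * D ^ 2 * K ≤ 1 := by
    rw [← hqq, show 16 * D ^ 2 * (q * q) = 16 * (D * q) ^ 2 by ring, hDq]
    norm_num
  have hγ : 2 * D * B = 1 / 2 * (B / q) := by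
    rw [hD_def]
    field_simp
    norm_num
  -- None of these data depends on `w`, so they can be fixed before the learner is given.
  refine ⟨feature d, block 1 0 0, 0, max (1 + ENNReal.ofReal ((1 / 2 - d * D) * B))
    (ENNReal.ofReal B), 2 * D * B, hγ.ge, hγ.le, fun L => ?_⟩
  have hV : 0 ≤ (1 / 2 - d * D) * B := mul_nonneg (by linarith) hB0.le
  -- One horizon makes the remainders of both the visit count and the regret decomposition small.
  obtain ⟨n, hn⟩ : ∃ n : ℕ, (K * 2 ^ K + ((1 / 2 - d * D) * B * K + B) * 2 ^ K) *
      (1 - min (1 / 4) (1 / B) / 2) ^ n < 1 / 128 := by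
    have hr : 0 < min (1 / 4) (1 / B) := lt_min (by norm_num) (by positivity)
    have ht := (tendsto_pow_atTop_nhds_zero_of_lt_one
      (by linarith [min_le_left (1 / 4) (1 / B)] : 0 ≤ 1 - min (1 / 4) (1 / B) / 2)
      (by linarith)).const_mul (K * 2 ^ K + ((1 / 2 - d * D) * B * K + B) * 2 ^ K)
    rw [mul_zero] at ht
    exact (ht.eventually (gt_mem_nhds (by norm_num))).exists
  have hβ : 0 ≤ (1 - min (1 / 4) (1 / B) / 2) ^ n :=
    pow_nonneg (by linarith [min_le_left (1 / 4) (1 / B)]) n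
  rw [add_mul] at hn
  have ha : 0 ≤ (K : ℝ) * 2 ^ K * (1 - min (1 / 4) (1 / B) / 2) ^ n :=
    mul_nonneg (by positivity) hβ
  have hb : 0 ≤ ((1 / 2 - d * D) * B * K + B) * 2 ^ K * (1 - min (1 / 4) (1 / B) / 2) ^ n :=
    mul_nonneg (mul_nonneg (add_nonneg (mul_nonneg hV (by linarith)) hB0.le) (by positivity)) hβ
  obtain ⟨w, hw⟩ := exists_le_sum_meanMiss (play_nonneg L) (sum_play L) hB hD.le hdD hK hDK n
  have hcost := le_total_stepCost_exitProb (play_nonneg L) (sum_play L) hB hD.le hdD hK n w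
  have hint := total_stepCost_le (exitProb D B w) L K n
  set T := total (play L) (fun s a => exitProb D B w s a) (fun s a => 1 - exitProb D B w s a)
    (stepCost K) n []
  have hle := exitProb_le_self (B := B) hD.le hdD w
  have hself := exitProb_zero_self (B := B) hD.le hdD w
  have hone := exitProb_one (D := D) hB w
  have hsum : 5 / 128 * (d * K : ℝ) ≤ ∑ i, meanMiss (play L) D B K n w i := by
    refine le_trans ?_ hw
    nlinarith
  have hreg : 1 / 64 * (B * d * q) ≤ T - K * ((1 / 2 - d * D) * B) := by
    have h1 := mul_le_mul_of_nonneg_left hsum (by positivity : 0 ≤ 2 * D * B)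
    have h2 : 2 * D * B * (5 / 128 * (d * K)) = 5 / 256 * (B * d * q) := by
      rw [← hqq, show 2 * D * B * (5 / 128 * (d * (q * q))) =
        5 / 64 * (B * d * q) * (D * q) by ring, hDq]
      ring
    -- This absorbs the remainder: `1/128 ≤ Bdq/256`, and `5/256 - 1/256 = 1/64`.
    have h3 : 2 ≤ B * d * q := by
      have : 2 ≤ B * d := by nlinarith
      nlinarith
    linarith
  have hexp : ((1 / 64 * (B * d * q) : ℝ) : EReal) ≤
      (ssp (exitProb D B w)).expectedRegret L K := by
    have hopt : ((ssp (exitProb D B w)).optValue (ssp (exitProb D B w)).init).toReal =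
        (1 / 2 - d * D) * B := by
      change ((ssp (exitProb D B w)).optValue 0).toReal = _
      rw [optValue_zero hB hone hle, hself, show (1 : ℝ) - (1 / 2 + d * D) = 1 / 2 - d * D by ring,
        ENNReal.toReal_ofReal hV]
    rw [SSP.expectedRegret, hopt]
    have hT : (T : EReal) ≤
        ((∫⁻ ω, (ssp (exitProb D B w)).totalCost K ω ∂((ssp (exitProb D B w)).law L) : ℝ≥0∞) :
          EReal) := by
      refine le_trans ?_ (EReal.coe_ennreal_le_coe_ennreal_iff.2 hint)
      rw [EReal.coe_ennreal_ofReal]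
      exact_mod_cast le_max_left T 0
    refine le_trans ?_ (EReal.sub_le_sub hT le_rfl)
    exact_mod_cast hreg
  have hbd : 0 ≤ B * d * q := by positivity
  refine ⟨ssp (exitProb D B w), rfl, isLinear hd hB hD.le hdD w,
    ⟨fun _ => w, isOptimal hB hone hle, ?_⟩, Bstar_eq hB hone hle,
    gapMin_eq (by omega) hB hD hdD w, le_trans ?_ hexp, le_trans ?_ hexp⟩
  · rw [iSup_fin_two, hittingTime_zero hB hone, hittingTime_one hB hone, hself,
      show (1 : ℝ) - (1 / 2 + d * D) = 1 / 2 - d * D by ring]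
  · rw [EReal.coe_le_coe_iff, hγ]
    refine le_of_eq ?_
    field_simp
    norm_num
  · rw [EReal.coe_le_coe_iff]
    linarith
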